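/- **Setting.** Let $\mathrm R$ be a (not necessarily crystallographic) finite root system with coroots $\alpha^\vee$, let $F\subseteq\mathbb R$ be a subfield containing all $\langle\alpha,\beta^\vee\rangle$ ($\alpha,\beta\in\mathrm R$), and let $\Lambda$ be a totally ordered abelian group with the structure of an ordered $F$-module (multiplication by non-negative elements of $F$ preserves the order). The model space is $\mathbb A=\mathrm{span}_F(\mathrm R)\otimes_F\Lambda$; the evaluations $\langle\cdot,\alpha^\vee\rangle:\mathbb A\to\Lambda$ and the action of the spherical Weyl group $\overline W$ on $\mathbb A$ are obtained by linear extension. Fix a basis $B$ of $\mathrm R$, with set of positive roots $\mathrm R^+$, and a non-trivial group $T\subseteq\mathbb A$ of translations normalized by $\overline W$. * $\overline WT$ is the group of maps $x\mapsto w(x)+t$, $w\in\overline W$, $t\in T$; the full affine Weyl group is the case $T=\mathbb A$. * The half-apartments of $\mathbb A$ are the sets $\{x:\langle x,\alpha^\vee\rangle\ge\lambda\}$ with $\alpha\in\mathrm R$, $\lambda\in\Lambda$; such a half-apartment is special if the reflection $x\mapsto r_\alpha(x)+\alpha\otimes\lambda$ in its bounding hyperplane lies in $\overline WT$. A subset of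 $\mathbb A$ is convex if it is the intersection of finitely many special half-apartments. * Weyl chambers of $\mathbb A$ are the images of $\{x:\langle x,\alpha^\vee\rangle\ge0\ \ \forall\alpha\in\mathrm R^+\}$ under the full affine Weyl group. * The distance on $\mathbb A$ is $d(x,y)=\sum_{\alpha\in\mathrm R^+}|\langle y-x,\alpha^\vee\rangle|\in\Lambda$. Let $X$ be a set and $\mathcal A$ a collection of injective maps (charts) $f:\mathbb A\to X$. Apartments, half-apartments and Weyl chambers of $X$ are the images of $\mathbb A$ and of its half-apartments and Weyl chambers under charts $f\in\mathcal A$. Consider the axioms: * (A1) If $f\in\mathcal A$ and $w\in\overline WT$, then $f\circ w\in\mathcal A$. * (A2) If $f,g\in\mathcal A$ and $f(\mathbb A)\cap g(\mathbb A)\ne\emptyset$, then $f^{-1}(g(\mathbb A))$ is a convex subset of $\mathbb A$ that is closed with respect to $d$, and there is $w\in\overline WT$ such that $f=g\circ w$ on $f^{-1}(g(\mathbb A))$. * (A3) Any two points of $X$ lie in a common apartment. * (A4) For any Weyl chambers $S_1,S_2$ of $X$ there are Weyl chambers $S_1'\subseteq S_1$, $S_2'\subseteq S_2$ of $X$ and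 $f\in\mathcal A$ with $S_1'\cup S_2'\subseteq f(\mathbb A)$. * (A6) If $f,g,h\in\mathcal A$ are such that the apartments $f(\mathbb A),g(\mathbb A),h(\mathbb A)$ pairwise intersect in half-apartments, then $f(\mathbb A)\cap g(\mathbb A)\cap h(\mathbb A)\neq\emptyset$. Under (A1)–(A3) there is a well-defined induced distance $d:X\times X\to\Lambda$: for $x,y\in X$, $d(x,y)$ is the distance in $\mathbb A$ of the preimages of $x$ and $y$ under a chart of any apartment containing both. **Statement.** Suppose $(X,\mathcal A)$ satisfies (A1), (A2), (A3), (A4) and (A6). Then the following are equivalent: * (A5) For every apartment $A$ and every $x\in A$ there exists a retraction $r_{A,x}:X\to A$ (a map that is the identity on $A$) with $d(r_{A,x}(y),r_{A,x}(z))\le d(y,z)$ for all $y,z\in X$ and $r_{A,x}^{-1}(x)=\{x\}$. * (A5') The induced distance satisfies the triangle inequality: $d(x,y)\le d(x,z)+d(z,y)$ for all $x,y,z\in X$. -/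

import Mathlib

open scoped TensorProduct

noncomputable section

namespace GenAffineBuilding

section Model

/-! Model spaces. `F` is a subfield of `ℝ`, `V` is the `F`-span of the roots of the (not
necessarily crystallographic) root system `P`, `Λ` is an ordered `F`-module, and the model space is
`V ⊗[F] Λ`. -/

variable {ι V N Λ : Type*} {F : Subfield ℝ}
variable [AddCommGroup V] [Module F V] [AddCommGroup N] [Module F N]
variable [AddCommGroup Λ] [LinearOrder Λ] [IsOrderedAddMonoid Λ] [Module F Λ]
variable (P : RootPairing ι F V N)

/-- `v` is a combination of the roots indexed by `B` with non-negative coefficients. -/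
def IsNonnegComb (B : Finset ι) (v : V) : Prop :=
  ∃ c : ι → F, (∀ j ∈ B, 0 ≤ c j) ∧ v = ∑ j ∈ B, c j • P.root j

/-- `B` (indexes) a basis of the root system: linearly independent roots such that every root is a
combination of them with all coefficients `≥ 0` or all coefficients `≤ 0`. -/
structure IsRootBasis (B : Finset ι) : Prop where
  linearIndepOn : LinearIndepOn F P.root (B : Set ι)
  nonneg_or_nonpos : ∀ i, IsNonnegComb P B (P.root i) ∨ IsNonnegComb P B (-P.root i)

/-- The root with index `i` is positive with respect to `B`. -/
def IsPositive (B : Finset ι) (i : ι) : Prop := IsNonnegComb P B (P.root i)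

variable (Λ) in
/-- The evaluation `x ↦ ⟨x, α^∨⟩` of the coroot of `α = P.root i` on the model space. -/
def coEval (i : ι) : V ⊗[F] Λ →ₗ[F] Λ :=
  (TensorProduct.lid F Λ).toLinearMap ∘ₗ (P.coroot' i).rTensor Λ

variable (Λ) in
/-- The linear reflection `r_α` on the model space. -/
def refl (i : ι) : (V ⊗[F] Λ) ≃ₗ[F] (V ⊗[F] Λ) :=
  LinearEquiv.rTensor Λ (P.reflection i)

variable (Λ) in
/-- The spherical Weyl group, acting on the model space. -/
def sphericalWeyl : Subgroup ((V ⊗[F] Λ) ≃ₗ[F] (V ⊗[F] Λ)) :=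
  Subgroup.closure (Set.range (refl Λ P))

/-- The translation group `T` is normalized by the spherical Weyl group. -/
def IsWeylStable (T : AddSubgroup (V ⊗[F] Λ)) : Prop :=
  ∀ w ∈ sphericalWeyl Λ P, ∀ t ∈ T, w t ∈ T

/-- The affine Weyl group with translation part `T`, as a set of self-maps of the model space:
all maps `x ↦ w x + t` with `w` in the spherical Weyl group and `t ∈ T`. -/
def affineWeyl (T : AddSubgroup (V ⊗[F] Λ)) : Set (V ⊗[F] Λ → V ⊗[F] Λ) :=
  {g | ∃ w ∈ sphericalWeyl Λ P, ∃ t ∈ T, g = fun x => w x + t}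

/-- The half-apartment `{x | ⟨x, α^∨⟩ ≥ c}`, bounded by the hyperplane `{x | ⟨x, α^∨⟩ = c}`.
(Replacing `α` by `-α` and `c` by `-c` gives the opposite half-apartment.) -/
def halfApartment (i : ι) (c : Λ) : Set (V ⊗[F] Λ) := {x | c ≤ coEval Λ P i x}

/-- The affine reflection `x ↦ r_α(x) + α ⊗ c`. -/
def affineRefl (i : ι) (c : Λ) : V ⊗[F] Λ → V ⊗[F] Λ :=
  fun x => refl Λ P i x + P.root i ⊗ₜ[F] c

/-- `Y` is a half-apartment of the model space. -/
def IsHalfApartment (Y : Set (V ⊗[F] Λ)) : Prop := ∃ i c, Y = halfApartment P i c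

/-- `Y` is a special half-apartment with respect to `T`: the reflection in its bounding hyperplane
belongs to the affine Weyl group with translation part `T`. -/
def IsSpecialHalfApartment (T : AddSubgroup (V ⊗[F] Λ)) (Y : Set (V ⊗[F] Λ)) : Prop :=
  ∃ i c, affineRefl P i c ∈ affineWeyl P T ∧ Y = halfApartment P i c

/-- `Y` is convex (with respect to `T`): an intersection of finitely many special
half-apartments. -/
def IsWTConvex (T : AddSubgroup (V ⊗[F] Λ)) (Y : Set (V ⊗[F] Λ)) : Prop :=
  ∃ S : Set (Set (V ⊗[F] Λ)), S.Finite ∧ (∀ H ∈ S, IsSpecialHalfApartment P T H) ∧ Y = ⋂₀ S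

variable (Λ) in
/-- The fundamental Weyl chamber with respect to `B`. -/
def fundChamber (B : Finset ι) : Set (V ⊗[F] Λ) :=
  {x | ∀ i, IsPositive P B i → 0 ≤ coEval Λ P i x}

/-- Weyl chambers of the model space: images of the fundamental Weyl chamber under the full affine
Weyl group. -/
def IsWeylChamber (B : Finset ι) (S : Set (V ⊗[F] Λ)) : Prop :=
  ∃ g ∈ affineWeyl P (⊤ : AddSubgroup (V ⊗[F] Λ)), S = g '' fundChamber Λ P B

open Classical in
/-- The `Λ`-valued distance `d(x, y) = ∑_{α > 0} |⟨y - x, α^∨⟩|` on the model space. -/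
def modelDist [Fintype ι] (B : Finset ι) (x y : V ⊗[F] Λ) : Λ :=
  ∑ i with IsPositive P B i, |coEval Λ P i (y - x)|

/-- `Y` is closed for the distance on the model space. -/
def IsModelClosed [Fintype ι] (B : Finset ι) (Y : Set (V ⊗[F] Λ)) : Prop :=
  ∀ x ∉ Y, ∃ ε : Λ, 0 < ε ∧ ∀ y, modelDist P B x y < ε → y ∉ Y

end Model

section Building

variable {ι V N Λ X : Type*} {F : Subfield ℝ}
variable [AddCommGroup V] [Module F V] [AddCommGroup N] [Module F N]
variable [AddCommGroup Λ] [LinearOrder Λ] [IsOrderedAddMonoid Λ] [Module F Λ]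
variable (P : RootPairing ι F V N) (B : Finset ι)

/-- Weyl chambers of `X`: images of Weyl chambers of the model space under charts. -/
def IsWeylChamberOf (𝒜 : Set (V ⊗[F] Λ → X)) (S : Set X) : Prop :=
  ∃ f ∈ 𝒜, ∃ C, IsWeylChamber P B C ∧ S = f '' C

/-- Half-apartments of `X`: images of half-apartments of the model space under charts. -/
def IsHalfApartmentOf (𝒜 : Set (V ⊗[F] Λ → X)) (Y : Set X) : Prop :=
  ∃ f ∈ 𝒜, ∃ H, IsHalfApartment P H ∧ Y = f '' H

/-- All the axioms of a generalized affine building with atlas `𝒜`, modelled on the model space of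
`P` over `Λ` with translation group `T`, except axiom (A5). -/
structure IsBuildingWithoutA5 [Fintype ι] (T : AddSubgroup (V ⊗[F] Λ))
    (𝒜 : Set (V ⊗[F] Λ → X)) : Prop where
  injective : ∀ f ∈ 𝒜, Function.Injective f
  A1 : ∀ f ∈ 𝒜, ∀ w ∈ affineWeyl P T, f ∘ w ∈ 𝒜
  A2 : ∀ f ∈ 𝒜, ∀ g ∈ 𝒜, (Set.range f ∩ Set.range g).Nonempty →
    IsModelClosed P B (f ⁻¹' Set.range g) ∧ IsWTConvex P T (f ⁻¹' Set.range g) ∧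
      ∃ w ∈ affineWeyl P T, Set.EqOn f (g ∘ w) (f ⁻¹' Set.range g)
  A3 : ∀ x y : X, ∃ f ∈ 𝒜, x ∈ Set.range f ∧ y ∈ Set.range f
  A4 : ∀ S₁ S₂ : Set X, IsWeylChamberOf P B 𝒜 S₁ → IsWeylChamberOf P B 𝒜 S₂ →
    ∃ S₁' S₂' : Set X, IsWeylChamberOf P B 𝒜 S₁' ∧ S₁' ⊆ S₁ ∧
      IsWeylChamberOf P B 𝒜 S₂' ∧ S₂' ⊆ S₂ ∧ ∃ f ∈ 𝒜, S₁' ∪ S₂' ⊆ Set.range f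
  A6 : ∀ f ∈ 𝒜, ∀ g ∈ 𝒜, ∀ h ∈ 𝒜,
    IsHalfApartmentOf P 𝒜 (Set.range f ∩ Set.range g) →
    IsHalfApartmentOf P 𝒜 (Set.range g ∩ Set.range h) →
    IsHalfApartmentOf P 𝒜 (Set.range f ∩ Set.range h) →
    (Set.range f ∩ Set.range g ∩ Set.range h).Nonempty

open Classical in
/-- The distance on `X` induced by the distance on the model space: the distance of the preimages
of `x` and `y` under a chart of an apartment containing both (and `0` if there is no such chart).
Independence of the chart is `inducedDist_eq` below. -/
def inducedDist [Fintype ι] (𝒜 : Set (V ⊗[F] Λ → X)) (x y : X) : Λ :=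
  if h : ∃ q : (V ⊗[F] Λ → X) × (V ⊗[F] Λ) × (V ⊗[F] Λ),
      q.1 ∈ 𝒜 ∧ q.1 q.2.1 = x ∧ q.1 q.2.2 = y
  then modelDist P B h.choose.2.1 h.choose.2.2 else 0

/-- Axiom (A5): for every apartment `A` and every `x ∈ A` there is a retraction `r` of `X` onto `A`
that does not increase distances and satisfies `r⁻¹(x) = {x}`. -/
def AxiomA5 [Fintype ι] (𝒜 : Set (V ⊗[F] Λ → X)) : Prop :=
  ∀ f ∈ 𝒜, ∀ x ∈ Set.range f, ∃ r : X → X,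
    (∀ y, r y ∈ Set.range f) ∧ (∀ y ∈ Set.range f, r y = y) ∧
    (∀ y z, inducedDist P B 𝒜 (r y) (r z) ≤ inducedDist P B 𝒜 y z) ∧
    r ⁻¹' {x} = {x}

/-- Axiom (A5'): the induced distance satisfies the triangle inequality. -/
def AxiomA5' [Fintype ι] (𝒜 : Set (V ⊗[F] Λ → X)) : Prop :=
  ∀ x y z : X, inducedDist P B 𝒜 x y ≤ inducedDist P B 𝒜 x z + inducedDist P B 𝒜 z y

end Building

section Facts

set_option linter.unusedSectionVars false

variable {ι V N Λ X : Type*} {F : Subfield ℝ}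
variable [AddCommGroup V] [Module F V] [AddCommGroup N] [Module F N]
variable [AddCommGroup Λ] [LinearOrder Λ] [IsOrderedAddMonoid Λ] [Module F Λ]
variable {P : RootPairing ι F V N} {B : Finset ι}

theorem coEval_tmul (i : ι) (v : V) (c : Λ) :
    coEval Λ P i (v ⊗ₜ[F] c) = P.coroot' i v • c := by
  simp [coEval]

theorem refl_apply (i : ι) (x : V ⊗[F] Λ) :
    refl Λ P i x = x - P.root i ⊗ₜ[F] coEval Λ P i x := by
  induction x using TensorProduct.induction_on with
  | zero => simp
  | tmul v c =>
    simp [refl, coEval_tmul, RootPairing.reflection_apply, TensorProduct.sub_tmul,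
      TensorProduct.smul_tmul]
  | add x y hx hy => rw [map_add, map_add, hx, hy, TensorProduct.tmul_add]; abel

theorem coEval_refl (i j : ι) (x : V ⊗[F] Λ) :
    coEval Λ P j (refl Λ P i x) = coEval Λ P (P.reflectionPerm i j) x := by
  induction x using TensorProduct.induction_on with
  | zero => simp
  | tmul v c =>
    simp only [refl, LinearEquiv.rTensor_tmul, coEval_tmul, RootPairing.coroot'_reflection]
  | add x y hx hy => rw [map_add, map_add, map_add, hx, hy]

/-- Fixed points of an affine reflection form the corresponding hyperplane. -/
theorem affineRefl_eq_self_iff (i : ι) (c : Λ) (x : V ⊗[F] Λ) :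
    affineRefl P i c x = x ↔ coEval Λ P i x = c := by
  constructor
  · intro h
    have h1 : P.root i ⊗ₜ[F] (c - coEval Λ P i x) = 0 := by
      rw [affineRefl, refl_apply] at h
      rw [TensorProduct.tmul_sub]
      calc _ = (x - P.root i ⊗ₜ[F] coEval Λ P i x + P.root i ⊗ₜ[F] c) - x := by abel
        _ = 0 := by rw [h, sub_self]
    have h2 := congrArg (coEval Λ P i) h1
    rw [coEval_tmul, map_zero, RootPairing.root_coroot'_eq_pairing, RootPairing.pairing_same] at h2
    have h3 : c - coEval Λ P i x = 0 := by
      have h4 : (2 : F) ≠ 0 := two_ne_zero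
      exact (smul_eq_zero_iff_right h4).1 h2
    exact (sub_eq_zero.1 h3).symm
  · rintro rfl
    rw [affineRefl, refl_apply]; abel

theorem coEval_reflectionPerm_self (i : ι) (x : V ⊗[F] Λ) :
    coEval Λ P (P.reflectionPerm i i) x = -coEval Λ P i x := by
  rw [← coEval_refl, refl_apply, map_sub, coEval_tmul, RootPairing.root_coroot'_eq_pairing,
    RootPairing.pairing_same, two_smul]
  abel

theorem isPositive_neg_iff [Fintype ι] (hB : IsRootBasis P B) (i : ι) :
    IsPositive P B (P.reflectionPerm i i) ↔ ¬ IsPositive P B i := by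
  have hr : P.root (P.reflectionPerm i i) = -P.root i := by
    simp
  constructor
  · rintro ⟨c, hc, h⟩ ⟨c', hc', h'⟩
    rw [hr] at h
    have hsum : ∑ j ∈ B, (c j + c' j) • P.root j = 0 := by
      simp only [add_smul, Finset.sum_add_distrib, ← h, ← h', neg_add_cancel]
    have h0 := linearIndepOn_finset_iff.1 hB.linearIndepOn _ hsum
    have h1 : P.root i = 0 := by
      rw [h']
      refine Finset.sum_eq_zero fun j hj => ?_
      have h2 : c' j = 0 := le_antisymm
        (by have h3 := h0 j hj; have h4 := hc j hj; rw [← h3]; exact le_add_of_nonneg_left h4)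
        (hc' j hj)
      rw [h2, zero_smul]
    exact P.ne_zero i h1
  · intro h
    rw [IsPositive, hr]
    exact (hB.nonneg_or_nonpos i).resolve_left h

/-- The distance is half the sum over all roots, hence Weyl-invariant. -/
theorem two_nsmul_modelDist [Fintype ι] (hB : IsRootBasis P B) (x y : V ⊗[F] Λ) :
    2 • modelDist P B x y = ∑ i, |coEval Λ P i (y - x)| := by
  classical
  have hr : ∀ k, P.root (P.reflectionPerm k k) = -P.root k := fun k => by simp
  have h : ∑ i with IsPositive P B i, |coEval Λ P i (y - x)| =
      ∑ i with ¬ IsPositive P B i, |coEval Λ P i (y - x)| := by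
    refine Finset.sum_nbij' (fun i => P.reflectionPerm i i) (fun i => P.reflectionPerm i i)
      ?_ ?_ ?_ ?_ ?_
    · intro i hi
      simp only [Finset.mem_filter, Finset.mem_univ, true_and] at hi ⊢
      rw [isPositive_neg_iff hB]; exact not_not.2 hi
    · intro i hi
      simp only [Finset.mem_filter, Finset.mem_univ, true_and] at hi ⊢
      exact (isPositive_neg_iff hB i).2 hi
    · intro i _; apply P.root.injective; simp only [hr, neg_neg]
    · intro i _; apply P.root.injective; simp only [hr, neg_neg]
    · intro i _; rw [coEval_reflectionPerm_self, abs_neg]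
  rw [← Finset.sum_filter_add_sum_filter_not Finset.univ (fun i => IsPositive P B i), ← h,
    two_nsmul, modelDist]

theorem modelDist_weyl [Fintype ι] (hB : IsRootBasis P B)
    {w : (V ⊗[F] Λ) ≃ₗ[F] (V ⊗[F] Λ)} (hw : w ∈ sphericalWeyl Λ P) (x y : V ⊗[F] Λ) :
    modelDist P B (w x) (w y) = modelDist P B x y := by
  induction hw using Subgroup.closure_induction generalizing x y with
  | mem w hw =>
    obtain ⟨i, rfl⟩ := hw
    apply nsmul_right_injective (two_ne_zero (α := ℕ))
    simp only [two_nsmul_modelDist hB, ← map_sub, coEval_refl]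
    exact Equiv.sum_comp (P.reflectionPerm i) (fun j => |coEval Λ P j (y - x)|)
  | one => rfl
  | mul a b _ _ ha hb => rw [LinearEquiv.mul_apply, LinearEquiv.mul_apply, ha, hb]
  | inv a _ ha =>
    rw [← ha]
    have h : ∀ z, a (a⁻¹ z) = z := fun z => a.apply_symm_apply z
    rw [h, h]

theorem modelDist_affineWeyl [Fintype ι] (hB : IsRootBasis P B) {T : AddSubgroup (V ⊗[F] Λ)}
    {g : V ⊗[F] Λ → V ⊗[F] Λ} (hg : g ∈ affineWeyl P T) (x y : V ⊗[F] Λ) :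
    modelDist P B (g x) (g y) = modelDist P B x y := by
  obtain ⟨w, hw, t, -, rfl⟩ := hg
  rw [← modelDist_weyl hB hw x y]
  simp only [modelDist, add_sub_add_right_eq_sub]

/-- The induced distance can be computed in any chart. -/
theorem inducedDist_eq [Fintype ι] (hB : IsRootBasis P B) {T : AddSubgroup (V ⊗[F] Λ)}
    {𝒜 : Set (V ⊗[F] Λ → X)} (h : IsBuildingWithoutA5 P B T 𝒜)
    {f : V ⊗[F] Λ → X} (hf : f ∈ 𝒜) (x y : V ⊗[F] Λ) :
    inducedDist P B 𝒜 (f x) (f y) = modelDist P B x y := by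
  have hex : ∃ q : (V ⊗[F] Λ → X) × (V ⊗[F] Λ) × (V ⊗[F] Λ),
      q.1 ∈ 𝒜 ∧ q.1 q.2.1 = f x ∧ q.1 q.2.2 = f y := ⟨(f, x, y), hf, rfl, rfl⟩
  rw [inducedDist, dif_pos hex]
  obtain ⟨h1, h2, h3⟩ := hex.choose_spec
  generalize hex.choose = q at h1 h2 h3
  obtain ⟨-, -, w, hw, he⟩ := h.A2 f hf q.1 h1 ⟨f x, ⟨x, rfl⟩, ⟨_, h2⟩⟩
  have hx : q.2.1 = w x := h.injective _ h1 (h2.trans (he (show x ∈ f ⁻¹' Set.range q.1 from ⟨_, h2⟩)))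
  have hy : q.2.2 = w y := h.injective _ h1 (h3.trans (he (show y ∈ f ⁻¹' Set.range q.1 from ⟨_, h3⟩)))
  rw [hx, hy, modelDist_affineWeyl hB hw]

end Facts

end GenAffineBuilding

end

/-! (A5) gives (A5') by retracting onto an apartment through `x` and `y`: the third point lands in
that apartment, where the triangle inequality is the one of the model space (`axiomA5'_of_axiomA5`).

For the converse, the retraction onto the apartment of `f` is centred at the germ of a sector at
`a`: a point is read off in any chart that agrees with `f` on this germ. It is well defined because
transition maps are affine Weyl elements and these are determined on a germ. It must be shown that
such charts reach every point, and that finitely many of their apartments cover a given apartment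
(`exists_cover`). The retraction is then isometric on each of finitely many convex pieces of any
apartment, and subdividing segments shows that it does not increase distances
(`modelDist_le_of_piecewise`).

The triangle inequality is exploited through rays. Rays with a common parallel ray stay at bounded
distance, so the rate at which two rays diverge, measured by `rootNorm`, does not depend on the
apartment used. The rates between a generic ray in a panel and all rays of a fixed chamber determine
the position of the panel (`eq_or_eq_mul_reflW`). Hence the chambers at infinity, with the
Weyl-valued `Dist` provided by (A4), satisfy the adjacency rule of a spherical building
(`Dist.mul_reflW`) and have unique projections to panels (`Dist.gate`).

From projections and opposite chambers one gets apartments that share a half-apartment with a given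
one (`exists_half`). Axiom (A6) makes two such half-apartments overlap, which is the exchange
condition `exists_exchange`. Since one of two overlapping halves contains any given germ, a germ can
be kept while a gallery at infinity is followed (`exists_germEq_asym`). A maximal-length argument
finds in every apartment through a point a chamber at infinity opposite to a given sector there
(`exists_opposite_sector`).

For the cover, take an apartment through a point `y` and the centre, and a sector at `y` containing
the centre. The given apartment through `y` has a chamber at infinity opposite to this sector, so
the sector from the centre towards that chamber contains `y`. It lies in the apartment chosen for
the germ and that chamber, and there are only finitely many chambers to choose for. -/

noncomputable section

namespace GenAffineBuilding

set_option linter.unusedSectionVars false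

/-! ### The Weyl group: reflections, conjugation, finiteness. -/

section WeylGroup

variable {ι V N Λ : Type*} {F : Subfield ℝ}
variable [AddCommGroup V] [Module F V] [AddCommGroup N] [Module F N]
variable {P : RootPairing ι F V N}

instance smulCommClass_weylGroup : SMulCommClass F P.weylGroup V :=
  SMulCommClass.symm _ _ _

theorem weylGroup_induction {p : P.weylGroup → Prop}
    (refl : ∀ i, p (RootPairing.weylGroup.ofIdx P i)) (one : p 1)
    (mul : ∀ x y, p x → p y → p (x * y)) (w : P.weylGroup) : p w := by
  obtain ⟨w, hw⟩ := w
  induction hw using RootPairing.weylGroup.induction with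
  | mem i => exact refl i
  | one => exact one
  | mul x y hx hy h1 h2 => exact mul _ _ h1 h2

variable (P) in
/-- The reflection in the root with index `i`, as an element of the Weyl group. -/
abbrev reflW (i : ι) : P.weylGroup := RootPairing.weylGroup.ofIdx P i

theorem root_smul (w : P.weylGroup) (i : ι) : P.root (w • i) = w • P.root i :=
  (RootPairing.weylGroup_apply_root P w i).symm

theorem reflW_smul (i : ι) (v : V) : reflW P i • v = v - P.coroot' i v • P.root i :=
  RootPairing.reflection_apply P i v

theorem coroot'_smul (w : P.weylGroup) (i : ι) (v : V) :
    P.coroot' (w • i) (w • v) = P.coroot' i v := by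
  induction w using weylGroup_induction generalizing i v with
  | refl j =>
    change P.coroot' (P.reflectionPerm j i) (P.reflection j v) = _
    rw [RootPairing.coroot'_reflection]
    simp
  | one => simp
  | mul x y hx hy => rw [mul_smul, mul_smul, hx, hy]

theorem coroot'_smul' (w : P.weylGroup) (i : ι) (v : V) :
    P.coroot' i (w • v) = P.coroot' (w⁻¹ • i) v := by
  rw [← coroot'_smul w (w⁻¹ • i), smul_inv_smul]

theorem weyl_ext {u w : P.weylGroup} (h : ∀ v : V, u • v = w • v) : u = w := by
  apply Subtype.ext
  apply RootPairing.Equiv.weightHom_injective P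
  ext v
  exact h v

theorem reflW_mul_self (i : ι) : reflW P i * reflW P i = 1 := by
  refine weyl_ext fun v => ?_
  rw [mul_smul, one_smul]
  exact P.reflection_same i v

theorem reflW_inv (i : ι) : (reflW P i)⁻¹ = reflW P i :=
  inv_eq_of_mul_eq_one_left (reflW_mul_self i)

theorem reflW_reflW_smul {β : Type*} [MulAction P.weylGroup β] (i : ι) (x : β) :
    reflW P i • reflW P i • x = x := by
  rw [← mul_smul, reflW_mul_self, one_smul]

theorem root_reflW_self (i : ι) : P.root (reflW P i • i) = -P.root i := by
  rw [root_smul]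
  exact P.reflection_apply_self i

theorem conj_reflW (w : P.weylGroup) (i : ι) : w * reflW P i * w⁻¹ = reflW P (w • i) := by
  refine weyl_ext fun v => ?_
  rw [mul_smul, mul_smul, reflW_smul, reflW_smul, smul_sub, smul_inv_smul, smul_comm w,
    root_smul, coroot'_smul', inv_inv]

theorem mul_reflW (w : P.weylGroup) (i : ι) : w * reflW P i = reflW P (w • i) * w := by
  rw [← conj_reflW]; group

theorem reflW_ne_one (i : ι) : reflW P i ≠ 1 := by
  intro h
  have h1 := root_reflW_self (P := P) i
  rw [h, one_smul] at h1
  have h2 := congrArg (P.coroot' i) h1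
  rw [map_neg, RootPairing.root_coroot'_eq_pairing, RootPairing.pairing_same] at h2
  norm_num at h2

section Form

variable [Fintype ι]

theorem rootForm_self_pos (i : ι) : 0 < P.RootForm (P.root i) (P.root i) := by
  rw [P.rootForm_apply_apply]
  refine Finset.sum_pos' (fun j _ => mul_self_nonneg _) ⟨i, Finset.mem_univ _, ?_⟩
  rw [RootPairing.root_coroot'_eq_pairing, RootPairing.pairing_same]
  norm_num

/-- This is the identity α^∨ = 2(α,·)/(α,α) with the denominator cleared. It turns statements about
coroots into statements about the positive root form. -/
theorem rootForm_mul_coroot' (i : ι) (v : V) :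
    P.RootForm (P.root i) (P.root i) * P.coroot' i v = 2 * P.RootForm (P.root i) v := by
  have h := congrArg (P.toLinearMap v) (P.rootForm_self_smul_coroot i)
  simp only [map_smul, map_nsmul, P.toLinearMap_apply_apply_Polarization] at h
  rw [smul_eq_mul, nsmul_eq_mul] at h
  exact h

/-- Proportional roots have proportional coroots. -/
theorem coroot'_of_root_eq_smul {i k : ι} {c : F}
    (h : P.root k = c • P.root i) : c • P.coroot' k = P.coroot' i := by
  have hc : c ≠ 0 := by
    rintro rfl
    exact P.ne_zero k (by rw [h, zero_smul])
  refine LinearMap.ext fun v => ?_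
  have h1 := rootForm_mul_coroot' (P := P) k v
  have h2 := rootForm_mul_coroot' (P := P) i v
  simp only [h, map_smul, LinearMap.smul_apply, smul_eq_mul] at h1
  have h3 := (rootForm_self_pos (P := P) i).ne'
  rw [LinearMap.smul_apply, smul_eq_mul]
  apply mul_left_cancel₀ h3
  apply mul_left_cancel₀ hc
  linear_combination h1 - c * h2

theorem reflW_eq_of_root_eq_smul {i k : ι} {c : F} (h : P.root k = c • P.root i) :
    reflW P k = reflW P i := by
  refine weyl_ext fun v => ?_
  rw [reflW_smul, reflW_smul, h, ← coroot'_of_root_eq_smul h, smul_smul, LinearMap.smul_apply,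
    smul_eq_mul, mul_comm]

/-- The roots span `V`, so the action on the finite index set of roots is faithful. -/
instance finite_weylGroup [P.IsRootSystem] : Finite P.weylGroup := by
  refine Finite.of_injective (fun w : P.weylGroup => fun i : ι => w • i) fun u w h => ?_
  refine weyl_ext fun v => ?_
  have hv : v ∈ Submodule.span F (Set.range P.root) := by
    rw [RootPairing.IsRootSystem.span_root_eq_top]; trivial
  induction hv using Submodule.span_induction with
  | mem x hx =>
    obtain ⟨i, rfl⟩ := hx
    rw [← root_smul, ← root_smul]
    exact congrArg P.root (congrFun h i)
  | zero => simp
  | add x y _ _ hx hy => rw [smul_add, smul_add, hx, hy]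
  | smul c x _ hx => rw [smul_comm u, smul_comm w, hx]

theorem eq_zero_of_coroot' [P.IsRootSystem] {v : V} (h : ∀ i, P.coroot' i v = 0) : v = 0 := by
  have h1 : P.toLinearMap v = 0 := by
    refine LinearMap.ext_on_range (v := P.coroot) RootPairing.IsRootSystem.span_coroot_eq_top ?_
    intro i
    exact h i
  exact P.toPerfPair.injective (by rw [map_zero]; exact h1)

end Form

end WeylGroup

/-! ### Positive roots, multiples of roots, simple coroots and fundamental weights. -/

section PositiveRoots

variable {ι V N : Type*} {F : Subfield ℝ}
variable [AddCommGroup V] [Module F V] [AddCommGroup N] [Module F N]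
variable {P : RootPairing ι F V N} {B : Finset ι}

variable (P) in
/-- The root with index `k` is a multiple of the root with index `i`. -/
def IsRay (i k : ι) : Prop := ∃ c : F, P.root k = c • P.root i

theorem smul_reflW_self (w : P.weylGroup) (i : ι) :
    w • reflW P i • i = reflW P (w • i) • w • i := by
  apply P.root.injective
  rw [root_reflW_self, root_smul, root_reflW_self, root_smul, smul_neg]

theorem IsRay.smul {i k : ι} (h : IsRay P i k) (w : P.weylGroup) : IsRay P (w • i) (w • k) := by
  obtain ⟨c, hc⟩ := h
  exact ⟨c, by rw [root_smul, root_smul, hc, smul_comm]⟩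

theorem IsRay.reflW_eq [Fintype ι] {i k : ι} (h : IsRay P i k) : reflW P k = reflW P i := by
  obtain ⟨c, hc⟩ := h
  exact reflW_eq_of_root_eq_smul hc

theorem isRay_reflW_self (i : ι) : IsRay P i (reflW P i • i) :=
  ⟨-1, by rw [root_reflW_self, neg_one_smul]⟩

theorem isPositive_of_mem {i : ι} (hi : i ∈ B) : IsPositive P B i := by
  classical
  refine ⟨fun j => if j = i then 1 else 0, fun j _ => by dsimp only; split_ifs <;> norm_num, ?_⟩
  simp [hi]

theorem isPositive_reflW_self [Fintype ι] (hB : IsRootBasis P B) (i : ι) :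
    IsPositive P B (reflW P i • i) ↔ ¬ IsPositive P B i :=
  isPositive_neg_iff hB i

open Classical in
/-- Coordinates with respect to a basis of the root system. -/
theorem exists_coord [P.IsRootSystem] (hB : IsRootBasis P B) :
    ∃ e : ι → V →ₗ[F] F, (∀ k ∈ B, ∀ j ∈ B, e k (P.root j) = if k = j then 1 else 0) ∧
      ∀ v, v = ∑ k ∈ B, e k v • P.root k := by
  have hspan : ⊤ ≤ Submodule.span F (Set.range fun j : B => P.root j) := by
    rw [← RootPairing.IsRootSystem.span_root_eq_top (P := P), Submodule.span_le]
    rintro _ ⟨i, rfl⟩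
    have key : ∀ v, IsNonnegComb P B v →
        v ∈ Submodule.span F (Set.range fun j : B => P.root j) := by
      rintro v ⟨c, -, rfl⟩
      exact Submodule.sum_mem _ fun j hj =>
        Submodule.smul_mem _ _ (Submodule.subset_span ⟨⟨j, hj⟩, rfl⟩)
    rcases hB.nonneg_or_nonpos i with h | h
    · exact key _ h
    · exact (Submodule.neg_mem_iff _).1 (key _ h)
  let b : Module.Basis B F V := Module.Basis.mk hB.linearIndepOn hspan
  have hb : ∀ j : B, b j = P.root j := fun j => by simp [b]
  refine ⟨fun k => if h : k ∈ B then b.coord ⟨k, h⟩ else 0, ?_, ?_⟩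
  · intro k hk j hj
    simp only [hk, dif_pos]
    rw [← hb ⟨j, hj⟩, Module.Basis.coord_apply, Module.Basis.repr_self, Finsupp.single_apply]
    simp only [Subtype.mk.injEq, eq_comm]
  · intro v
    conv_lhs => rw [← b.sum_repr v]
    rw [← Finset.sum_coe_sort B]
    refine Finset.sum_congr rfl fun k _ => ?_
    rw [hb]
    simp

variable [Fintype ι] [P.IsRootSystem]

open Classical in
theorem isPositive_iff_coord (hB : IsRootBasis P B) {e : ι → V →ₗ[F] F}
    (he : ∀ k ∈ B, ∀ j ∈ B, e k (P.root j) = if k = j then 1 else 0) (i : ι) :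
    (IsPositive P B i → ∀ k ∈ B, 0 ≤ e k (P.root i)) ∧
      (¬ IsPositive P B i → ∀ k ∈ B, e k (P.root i) ≤ 0) := by
  have key : ∀ v, IsNonnegComb P B v → ∀ k ∈ B, 0 ≤ e k v := by
    rintro v ⟨c, hc, rfl⟩ k hk
    rw [map_sum]
    refine Finset.sum_nonneg fun j hj => ?_
    rw [map_smul, he k hk j hj, smul_eq_mul]
    refine mul_nonneg (hc j hj) ?_
    split_ifs <;> norm_num
  refine ⟨key _, fun h k hk => ?_⟩
  have h1 := key _ ((hB.nonneg_or_nonpos i).resolve_left h) k hk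
  rw [map_neg] at h1
  exact neg_nonneg.1 h1

theorem isPositive_of_isRay (hB : IsRootBasis P B) {i k : ι} {c : F}
    (h : P.root k = c • P.root i) (hi : IsPositive P B i) : IsPositive P B k ↔ 0 < c := by
  have key : ∀ (c : F) k, P.root k = c • P.root i → 0 < c → IsPositive P B k := by
    rintro c k h hc
    obtain ⟨d, hd, hi⟩ := hi
    refine ⟨fun j => c * d j, fun j hj => mul_nonneg hc.le (hd j hj), ?_⟩
    rw [h, hi, Finset.smul_sum]
    simp only [smul_smul]
  have hc : c ≠ 0 := by
    rintro rfl
    exact P.ne_zero k (by rw [h, zero_smul])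
  refine ⟨fun hk => ?_, key c k h⟩
  by_contra hn
  have h1 : 0 < -c := neg_pos.2 (lt_of_le_of_ne (not_lt.1 hn) hc)
  refine (isPositive_reflW_self hB k).1 (key (-c) _ ?_ h1) hk
  rw [root_reflW_self, h, neg_smul]

/-- The root system need not be reduced, so sign arguments for a simple root have to be transferred
to its other positive multiples. -/
theorem IsRay.isPositive_smul (hB : IsRootBasis P B) {i k : ι} (h : IsRay P i k)
    (hi : IsPositive P B i) (hk : IsPositive P B k) (w : P.weylGroup) :
    IsPositive P B (w • k) ↔ IsPositive P B (w • i) := by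
  obtain ⟨c, hc⟩ := h
  have h1 := (isPositive_of_isRay hB hc hi).1 hk
  have h2 : P.root (w • k) = c • P.root (w • i) := by
    rw [root_smul, root_smul, hc, smul_comm]
  constructor
  · intro h3
    refine (isPositive_of_isRay hB (c := c⁻¹) ?_ h3).2 (inv_pos.2 h1)
    rw [h2, inv_smul_smul₀ h1.ne']
  · intro h3
    exact (isPositive_of_isRay hB h2 h3).2 h1

/-- A simple reflection permutes the positive roots that are not multiples of the simple root. -/
theorem isRay_of_reflW (hB : IsRootBasis P B) {i j : ι} (hi : i ∈ B) (hj : IsPositive P B j)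
    (h : ¬ IsPositive P B (reflW P i • j)) : IsRay P i j := by
  obtain ⟨e, he, hs⟩ := exists_coord hB
  refine ⟨e i (P.root j), ?_⟩
  conv_lhs => rw [hs (P.root j)]
  refine Finset.sum_eq_single i (fun k hk hki => ?_) (fun h => absurd hi h)
  have h1 := (isPositive_iff_coord hB he j).1 hj k hk
  have h2 := (isPositive_iff_coord hB he _).2 h k hk
  rw [root_smul, reflW_smul, map_sub, map_smul, he k hk i hi, if_neg hki, smul_zero,
    sub_zero] at h2
  rw [le_antisymm h2 h1, zero_smul]

theorem isPositive_reflW_of_not_isRay (hB : IsRootBasis P B) {i j : ι} (hi : i ∈ B)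
    (hj : IsPositive P B j) (h : ¬ IsRay P i j) : IsPositive P B (reflW P i • j) := by
  by_contra hn
  exact h (isRay_of_reflW hB hi hj hn)

/-- Through the root form, an expansion of a root becomes one of its coroot, with coefficients
rescaled by ratios of squared lengths. These ratios are positive, so signs survive. -/
theorem coroot'_eq_sum {i : ι} {c : ι → F} (h : P.root i = ∑ j ∈ B, c j • P.root j) :
    P.coroot' i = ∑ j ∈ B, (c j * P.RootForm (P.root j) (P.root j) /
      P.RootForm (P.root i) (P.root i)) • P.coroot' j := by
  refine LinearMap.ext fun v => ?_
  have h0 := (rootForm_self_pos (P := P) i).ne'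
  apply mul_left_cancel₀ h0
  rw [rootForm_mul_coroot' (P := P) i v]
  conv_lhs => rw [h]
  simp only [map_sum, map_smul, LinearMap.sum_apply, LinearMap.smul_apply, smul_eq_mul,
    Finset.mul_sum]
  refine Finset.sum_congr rfl fun j _ => ?_
  have h1 := rootForm_mul_coroot' (P := P) j v
  field_simp
  linear_combination -(c j) * h1

/-- Every positive coroot is a non-negative combination of the simple coroots. -/
theorem exists_coroot'_eq_sum {i : ι} (hi : IsPositive P B i) :
    ∃ c : ι → F, (∀ j ∈ B, 0 ≤ c j) ∧ P.coroot' i = ∑ j ∈ B, c j • P.coroot' j := by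
  obtain ⟨c, hc, h⟩ := hi
  exact ⟨_, fun j hj => div_nonneg (mul_nonneg (hc j hj) (rootForm_self_pos j).le)
    (rootForm_self_pos i).le, coroot'_eq_sum h⟩

open Classical in
/-- Fundamental weights: the basis dual to the simple coroots. -/
theorem exists_fundWeight (hB : IsRootBasis P B) :
    ∃ ω : ι → V, ∀ i ∈ B, ∀ j ∈ B, P.coroot' i (ω j) = if i = j then 1 else 0 := by
  have hspan : ⊤ ≤ Submodule.span F (Set.range fun j : B => P.root j) := by
    obtain ⟨e, -, hs⟩ := exists_coord hB
    intro v _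
    rw [hs v]
    exact Submodule.sum_mem _ fun j hj =>
      Submodule.smul_mem _ _ (Submodule.subset_span ⟨⟨j, hj⟩, rfl⟩)
  let b : Module.Basis B F V := Module.Basis.mk hB.linearIndepOn hspan
  have : FiniteDimensional F V := b.finiteDimensional_of_finite
  let E : V →ₗ[F] (B → F) := LinearMap.pi fun j : B => P.coroot' j
  have hinj : Function.Injective E := by
    rw [injective_iff_map_eq_zero]
    intro v hv
    have h1 : ∀ i, IsPositive P B i → P.coroot' i v = 0 := by
      intro i hi
      obtain ⟨c, -, h⟩ := exists_coroot'_eq_sum hi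
      rw [h, LinearMap.sum_apply]
      refine Finset.sum_eq_zero fun j hj => ?_
      have h2 : P.coroot' j v = 0 := congrFun hv ⟨j, hj⟩
      rw [LinearMap.smul_apply, h2, smul_zero]
    refine eq_zero_of_coroot' (P := P) fun i => ?_
    by_cases hi : IsPositive P B i
    · exact h1 i hi
    · have h2 := h1 _ ((isPositive_reflW_self hB i).2 hi)
      rw [← coroot'_smul (reflW P i), reflW_reflW_smul, reflW_smul, map_sub, map_smul,
        RootPairing.root_coroot'_eq_pairing, RootPairing.pairing_same, smul_eq_mul] at h2
      linear_combination -h2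
  have hfr : Module.finrank F V = Module.finrank F (B → F) := by
    rw [Module.finrank_eq_card_basis b, Module.finrank_fintype_fun_eq_card]
  -- There are as many simple coroots as dimensions, so evaluating them is bijective; the weights
  -- are preimages of the coordinate vectors.
  have hsurj := (LinearMap.injective_iff_surjective_of_finrank_eq_finrank hfr).1 hinj
  choose g hg using hsurj
  refine ⟨fun j => if h : j ∈ B then g (Pi.single ⟨j, h⟩ 1) else 0, fun i hi j hj => ?_⟩
  simp only [hj, dif_pos]
  have h1 : P.coroot' i (g (Pi.single ⟨j, hj⟩ 1)) = E (g (Pi.single ⟨j, hj⟩ 1)) ⟨i, hi⟩ := rfl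
  rw [h1, hg, Pi.single_apply]
  simp only [Subtype.mk.injEq]

end PositiveRoots

/-! ### Length, generation by simple reflections, deletion, the longest element. -/

section Length

variable {ι V N : Type*} {F : Subfield ℝ}
variable [AddCommGroup V] [Module F V] [AddCommGroup N] [Module F N]
variable {P : RootPairing ι F V N} {B : Finset ι} [Fintype ι]

open Classical in
/-- The number of positive roots made negative by `w`. -/
def len (B : Finset ι) (w : P.weylGroup) : ℕ :=
  (Finset.univ.filter fun i => IsPositive P B i ∧ ¬ IsPositive P B (w • i)).card

open Classical in
variable (P B) in
/-- The number of positive multiples of the root with index `i`. -/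
def rayMult (i : ι) : ℕ := (Finset.univ.filter fun j => IsPositive P B j ∧ IsRay P i j).card

theorem rayMult_pos {i : ι} (hi : i ∈ B) : 0 < rayMult P B i := by
  classical
  refine Finset.card_pos.2 ⟨i, ?_⟩
  simp only [Finset.mem_filter, Finset.mem_univ, true_and]
  exact ⟨isPositive_of_mem hi, 1, by rw [one_smul]⟩

theorem len_one : len B (1 : P.weylGroup) = 0 := by
  simp [len]

variable [P.IsRootSystem]

/-- The simple reflection permutes the positive roots off the ray of `i` and negates those on it.
Length counts all roots, including multiples, so it jumps by `rayMult` and not by 1. -/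
theorem len_mul_reflW (hB : IsRootBasis P B) {w : P.weylGroup} {i : ι} (hi : i ∈ B)
    (h : IsPositive P B (w • i)) : len B (w * reflW P i) = len B w + rayMult P B i := by
  classical
  have hip := isPositive_of_mem (P := P) hi
  rw [len, ← Finset.card_filter_add_card_filter_not (p := fun j => IsRay P i j), add_comm]
  congr 1
  · rw [len]
    refine Finset.card_nbij' (fun j => reflW P i • j) (fun j => reflW P i • j) ?_ ?_ ?_ ?_
    · intro j hj
      simp only [Finset.coe_filter, Finset.mem_filter, Finset.mem_univ, true_and,
        Set.mem_ofPred_eq, mul_smul] at hj ⊢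
      exact ⟨isPositive_reflW_of_not_isRay hB hi hj.1.1 hj.2, hj.1.2⟩
    · intro j hj
      simp only [Finset.coe_filter, Finset.mem_filter, Finset.mem_univ, true_and,
        Set.mem_ofPred_eq, mul_smul, reflW_reflW_smul] at hj ⊢
      have hr : ¬ IsRay P i j := fun hr => hj.2 ((hr.isPositive_smul hB hip hj.1 w).2 h)
      refine ⟨⟨isPositive_reflW_of_not_isRay hB hi hj.1 hr, hj.2⟩, fun hr' => hr ?_⟩
      obtain ⟨c, hc⟩ := hr'.smul (reflW P i)
      rw [reflW_reflW_smul, root_reflW_self] at hc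
      exact ⟨-c, by rw [hc, smul_neg, neg_smul]⟩
    · intro j _; exact reflW_reflW_smul i j
    · intro j _; exact reflW_reflW_smul i j
  · rw [rayMult]
    congr 1
    ext j
    simp only [Finset.mem_filter, Finset.mem_univ, true_and]
    constructor
    · rintro ⟨⟨h1, -⟩, h2⟩; exact ⟨h1, h2⟩
    · rintro ⟨h1, h2⟩
      refine ⟨⟨h1, ?_⟩, h2⟩
      rw [h2.isPositive_smul hB hip h1, mul_smul, smul_reflW_self, isPositive_reflW_self hB]
      exact not_not.2 h

theorem len_mul_reflW' (hB : IsRootBasis P B) {w : P.weylGroup} {i : ι} (hi : i ∈ B)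
    (h : ¬ IsPositive P B (w • i)) : len B w = len B (w * reflW P i) + rayMult P B i := by
  rw [← len_mul_reflW hB hi, mul_assoc, reflW_mul_self, mul_one]
  rw [mul_smul, smul_reflW_self, isPositive_reflW_self hB]
  exact h

/-- The map j ↦ -w⁻¹j carries the inversions of `w⁻¹` to those of `w`. -/
theorem len_inv (hB : IsRootBasis P B) (w : P.weylGroup) : len B w⁻¹ = len B w := by
  classical
  have hn : ∀ k : ι, reflW P (reflW P k • k) • reflW P k • k = k := fun k => by
    apply P.root.injective
    rw [root_reflW_self, root_reflW_self, neg_neg]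
  refine Finset.card_nbij' (fun j => reflW P (w⁻¹ • j) • w⁻¹ • j)
    (fun j => reflW P (w • j) • w • j) ?_ ?_ ?_ ?_
  · intro j hj
    simp only [Finset.coe_filter, Finset.mem_univ, true_and, Set.mem_ofPred_eq] at hj ⊢
    rw [smul_reflW_self, smul_inv_smul, isPositive_reflW_self hB, isPositive_reflW_self hB]
    exact ⟨hj.2, not_not.2 hj.1⟩
  · intro j hj
    simp only [Finset.coe_filter, Finset.mem_univ, true_and, Set.mem_ofPred_eq] at hj ⊢
    rw [smul_reflW_self, inv_smul_smul, isPositive_reflW_self hB, isPositive_reflW_self hB]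
    exact ⟨hj.2, not_not.2 hj.1⟩
  · intro j _
    dsimp only
    rw [smul_reflW_self w, smul_inv_smul, hn]
  · intro j _
    dsimp only
    rw [smul_reflW_self w⁻¹, inv_smul_smul, hn]

theorem len_reflW_mul' (hB : IsRootBasis P B) {w : P.weylGroup} {i : ι} (hi : i ∈ B)
    (h : ¬ IsPositive P B (w⁻¹ • i)) : len B w = len B (reflW P i * w) + rayMult P B i := by
  rw [← len_inv hB, ← len_inv hB (_ * _), mul_inv_rev, reflW_inv, ← len_mul_reflW' hB hi h]

/-- The Weyl group is generated by the simple reflections. -/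
theorem exists_list_prod (hB : IsRootBasis P B) (w : P.weylGroup) :
    ∃ L : List ι, (∀ i ∈ L, i ∈ B) ∧ (L.map (reflW P)).prod = w := by
  classical
  let cl : Set P.weylGroup := {w | ∃ L : List ι, (∀ i ∈ L, i ∈ B) ∧ (L.map (reflW P)).prod = w}
  have hmul : ∀ u v, u ∈ cl → v ∈ cl → u * v ∈ cl := by
    rintro _ _ ⟨L, hL, rfl⟩ ⟨L', hL', rfl⟩
    refine ⟨L ++ L', fun i hi => ?_, by simp⟩
    rcases List.mem_append.1 hi with h | h
    exacts [hL i h, hL' i h]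
  have hsim : ∀ i ∈ B, reflW P i ∈ cl := fun i hi => ⟨[i], by simpa using hi, by simp⟩
  have hone : (1 : P.weylGroup) ∈ cl := ⟨[], by simp, by simp⟩
  have hinv : ∀ u, u ∈ cl → u⁻¹ ∈ cl := by
    rintro _ ⟨L, hL, rfl⟩
    refine ⟨L.reverse, fun i hi => hL i (List.mem_reverse.1 hi), ?_⟩
    induction L with
    | nil => simp
    | cons a L ih =>
      rw [List.reverse_cons, List.map_append, List.prod_append,
        ih (fun i hi => hL i (List.mem_cons_of_mem _ hi)), List.map_cons (l := L), List.prod_cons,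
        mul_inv_rev, reflW_inv]
      simp
  obtain ⟨e, he, hs⟩ := exists_coord hB
  let ht : V →ₗ[F] F := ∑ k ∈ B, e k
  have hht : ∀ i ∈ B, ht (P.root i) = 1 := by
    intro i hi
    simp only [ht, LinearMap.sum_apply]
    rw [Finset.sum_eq_single i]
    · rw [he i hi i hi, if_pos rfl]
    · intro k hk hki; rw [he k hk i hi, if_neg hki]
    · intro h; exact absurd hi h
  have hpos : ∀ k, IsPositive P B k → reflW P k ∈ cl := by
    intro k hk
    -- Take a positive root of least height in the orbit of `k` under the simple reflections.
    -- Positivity of the root form gives a simple coroot that is positive on it, so the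
    -- corresponding reflection lowers the height. Minimality makes the reflected root negative, so
    -- the chosen root is a multiple of a simple one.
    let S : Finset ι := Finset.univ.filter fun j => IsPositive P B j ∧ ∃ u ∈ cl, u • k = j
    obtain ⟨j, hjS, hmin⟩ := S.exists_min_image (fun j => ht (P.root j))
      ⟨k, by simp only [S, Finset.mem_filter, Finset.mem_univ, true_and]
             exact ⟨hk, 1, hone, one_smul _ _⟩⟩
    simp only [S, Finset.mem_filter, Finset.mem_univ, true_and] at hjS
    obtain ⟨hj, u, hu, huj⟩ := hjS
    have h1 : ∃ l ∈ B, 0 < P.coroot' l (P.root j) := by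
      by_contra hcon
      push Not at hcon
      have h2 := rootForm_self_pos (P := P) j
      have h3 : P.RootForm (P.root j) (P.root j) ≤ 0 := by
        have hy : ∀ y, P.RootForm (P.root j) y = ∑ l ∈ B, e l (P.root j) * P.RootForm (P.root l) y := by
          intro y
          conv_lhs => rw [hs (P.root j)]
          simp only [map_sum, map_smul, LinearMap.sum_apply, LinearMap.smul_apply, smul_eq_mul]
        rw [hy]
        refine Finset.sum_nonpos fun l hl => ?_
        have h4 := rootForm_mul_coroot' (P := P) l (P.root j)
        have h5 := (isPositive_iff_coord hB he j).1 hj l hl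
        have h6 := mul_nonpos_of_nonneg_of_nonpos (rootForm_self_pos (P := P) l).le (hcon l hl)
        refine mul_nonpos_of_nonneg_of_nonpos h5 ?_
        rw [h4] at h6
        by_contra h7
        exact absurd (mul_pos two_pos (not_le.1 h7)) (not_lt.2 h6)
      exact absurd h2 (not_lt.2 h3)
    obtain ⟨l, hl, hlj⟩ := h1
    have h2 : ¬ IsPositive P B (reflW P l • j) := by
      intro hp
      have h3 := hmin (reflW P l • j) (by
        simp only [S, Finset.mem_filter, Finset.mem_univ, true_and]
        exact ⟨hp, reflW P l * u, hmul _ _ (hsim l hl) hu, by rw [mul_smul, huj]⟩)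
      rw [root_smul, reflW_smul, map_sub, map_smul, hht l hl, smul_eq_mul, mul_one] at h3
      exact absurd hlj (not_lt.2 (by simpa using h3))
    have h3 := (isRay_of_reflW hB hl hj h2).reflW_eq
    rw [← huj, ← conj_reflW] at h3
    have h4 : reflW P k = u⁻¹ * reflW P l * u := by rw [← h3]; group
    rw [h4]
    exact hmul _ _ (hmul _ _ (hinv _ hu) (hsim l hl)) hu
  have hall : ∀ k, reflW P k ∈ cl := by
    intro k
    by_cases hk : IsPositive P B k
    · exact hpos k hk
    · rw [← (isRay_reflW_self k).reflW_eq]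
      exact hpos _ ((isPositive_reflW_self hB k).2 hk)
  exact weylGroup_induction (p := fun w => w ∈ cl) hall hone hmul w

/-- The deletion property. -/
theorem exists_list_delete (hB : IsRootBasis P B) {i : ι} (hi : i ∈ B) (L : List ι)
    (hL : ∀ j ∈ L, j ∈ B) (h : ¬ IsPositive P B ((L.map (reflW P)).prod • i)) :
    ∃ L' : List ι, (∀ j ∈ L', j ∈ B) ∧ L'.length + 1 = L.length ∧
      (L'.map (reflW P)).prod = (L.map (reflW P)).prod * reflW P i := by
  induction L with
  | nil => simp only [List.map_nil, List.prod_nil, one_smul] at h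
           exact absurd (isPositive_of_mem hi) h
  | cons a L ih =>
    have ha := hL a List.mem_cons_self
    have hL1 : ∀ j ∈ L, j ∈ B := fun j hj => hL j (List.mem_cons_of_mem _ hj)
    rw [List.map_cons, List.prod_cons, mul_smul] at h
    -- If the root turns negative exactly at the letter `a`, the suffix maps `i` to a multiple of
    -- the root `a`. Moving the reflection in `i` past the suffix then cancels `a`.
    by_cases h1 : IsPositive P B ((L.map (reflW P)).prod • i)
    · have h2 := (isRay_of_reflW hB ha h1 h).reflW_eq
      refine ⟨L, hL1, rfl, ?_⟩
      rw [List.map_cons, List.prod_cons, mul_assoc, mul_reflW, h2, ← mul_assoc, reflW_mul_self,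
        one_mul]
    · obtain ⟨L', h2, h3, h4⟩ := ih hL1 h1
      refine ⟨a :: L', ?_, by rw [List.length_cons, List.length_cons, h3], ?_⟩
      · intro j hj
        rcases List.mem_cons.1 hj with rfl | hj
        exacts [ha, h2 j hj]
      · rw [List.map_cons, List.prod_cons, List.map_cons, List.prod_cons, h4, mul_assoc]

/-- If a word for `w` ends in `i` and `w` keeps `i` positive, then the preceding letters make `i`
negative, and deletion yields a word for `w` that is two letters shorter. -/
theorem eq_one_of_isPositive (hB : IsRootBasis P B) {w : P.weylGroup}
    (h : ∀ i ∈ B, IsPositive P B (w • i)) : w = 1 := by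
  obtain ⟨L, hL, rfl⟩ := exists_list_prod hB w
  generalize hn : L.length = n
  induction n using Nat.strong_induction_on generalizing L with
  | _ n ih =>
    rcases List.eq_nil_or_concat' L with rfl | ⟨L1, i, rfl⟩
    · simp
    · have hi : i ∈ B := hL i (by simp)
      have h1 : ¬ IsPositive P B ((L1.map (reflW P)).prod • i) := by
        have h2 := h i hi
        rw [List.map_append, List.prod_append, mul_smul] at h2
        simp only [List.map_cons, List.map_nil, List.prod_cons, List.prod_nil, mul_one] at h2
        rw [smul_reflW_self, isPositive_reflW_self hB] at h2
        exact h2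
      obtain ⟨L2, h2, h3, h4⟩ := exists_list_delete hB hi L1
        (fun j hj => hL j (List.mem_append_left _ hj)) h1
      have h5 : ((L1 ++ [i]).map (reflW P)).prod = (L2.map (reflW P)).prod := by
        rw [h4]; simp
      rw [h5] at h ⊢
      refine ih L2.length ?_ L2 h2 h rfl
      rw [← hn, List.length_append, ← h3]
      simp

theorem exists_not_isPositive (hB : IsRootBasis P B) {w : P.weylGroup} (hw : w ≠ 1) :
    ∃ i ∈ B, ¬ IsPositive P B (w • i) := by
  by_contra h
  push Not at h
  exact hw (eq_one_of_isPositive hB h)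

theorem eq_of_isPositive_iff (hB : IsRootBasis P B) {u w : P.weylGroup}
    (h : ∀ j, IsPositive P B (u⁻¹ • j) → IsPositive P B (w⁻¹ • j)) : u = w := by
  have h1 : w⁻¹ * u = 1 := eq_one_of_isPositive hB fun i hi => by
    rw [mul_smul]
    exact h _ (by rw [inv_smul_smul]; exact isPositive_of_mem hi)
  rw [← one_mul u, ← mul_inv_cancel w, mul_assoc, h1, mul_one]

/-- `w` makes all positive roots negative. -/
def IsLongest (B : Finset ι) (w : P.weylGroup) : Prop := ∀ i ∈ B, ¬ IsPositive P B (w • i)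

variable (P) in
theorem exists_isLongest (hB : IsRootBasis P B) : ∃ w : P.weylGroup, IsLongest B w := by
  obtain ⟨w, hw⟩ := Finite.exists_max (fun w : P.weylGroup => len B w)
  refine ⟨w, fun i hi h => ?_⟩
  have h1 := hw (w * reflW P i)
  rw [len_mul_reflW hB hi h] at h1
  have := rayMult_pos (P := P) hi
  omega

theorem IsLongest.not_isPositive (hB : IsRootBasis P B) {w : P.weylGroup} (hw : IsLongest B w)
    {j : ι} (hj : IsPositive P B j) : ¬ IsPositive P B (w • j) := by
  obtain ⟨c, hc, h⟩ := hj
  rw [← isPositive_reflW_self hB]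
  have h1 : ∀ i ∈ B, ∃ d : ι → F, (∀ j ∈ B, 0 ≤ d j) ∧
      w • P.root i = -∑ j ∈ B, d j • P.root j := by
    intro i hi
    obtain ⟨d, hd, h⟩ := (hB.nonneg_or_nonpos (w • i)).resolve_left (hw i hi)
    exact ⟨d, hd, by rw [← h, root_smul, neg_neg]⟩
  choose! d hd hdw using h1
  refine ⟨fun k => ∑ i ∈ B, c i * d i k,
    fun k hk => Finset.sum_nonneg fun i hi => mul_nonneg (hc i hi) (hd i hi k hk), ?_⟩
  rw [root_reflW_self, root_smul, h, Finset.smul_sum, ← Finset.sum_neg_distrib]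
  simp only [Finset.sum_smul]
  rw [Finset.sum_comm]
  refine Finset.sum_congr rfl fun i hi => ?_
  rw [smul_comm, hdw i hi, smul_neg, neg_neg, Finset.smul_sum]
  simp only [smul_smul]

theorem IsLongest.isPositive_inv (hB : IsRootBasis P B) {w : P.weylGroup} (hw : IsLongest B w)
    {j : ι} (hj : ¬ IsPositive P B j) : IsPositive P B (w⁻¹ • j) := by
  by_contra h
  rw [← isPositive_reflW_self hB] at h
  have h1 := hw.not_isPositive hB h
  rw [smul_reflW_self, smul_inv_smul, isPositive_reflW_self hB] at h1
  exact h1 hj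

theorem IsLongest.not_isPositive_inv (hB : IsRootBasis P B) {w : P.weylGroup}
    (hw : IsLongest B w) {j : ι} (hj : IsPositive P B j) : ¬ IsPositive P B (w⁻¹ • j) := by
  intro h
  have h1 := hw.not_isPositive hB h
  rw [smul_inv_smul] at h1
  exact h1 hj

theorem IsLongest.len_le (hB : IsRootBasis P B) {w : P.weylGroup} (hw : IsLongest B w)
    (u : P.weylGroup) : len B u ≤ len B w := by
  classical
  refine Finset.card_le_card fun i hi => ?_
  simp only [Finset.mem_filter, Finset.mem_univ, true_and] at hi ⊢
  exact ⟨hi.1, hw.not_isPositive hB hi.1⟩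

/-- Conjugation by the longest element permutes the simple reflections. -/
theorem IsLongest.exists_conj (hB : IsRootBasis P B) {w : P.weylGroup} (hw : IsLongest B w)
    {i : ι} (hi : i ∈ B) : ∃ l ∈ B, w * reflW P l = reflW P i * w := by
  have h1 : w⁻¹ * reflW P i * w ≠ 1 := by
    intro h
    apply reflW_ne_one (P := P) i
    calc reflW P i = w * (w⁻¹ * reflW P i * w) * w⁻¹ := by group
      _ = 1 := by rw [h]; group
  obtain ⟨l, hl, h⟩ := exists_not_isPositive hB h1
  refine ⟨l, hl, ?_⟩
  rw [mul_smul, mul_smul] at h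
  -- The positive root -w·l is made negative by the reflection in `i`, hence lies on the ray of `i`;
  -- the conjugate reflection is therefore the one in `l`.
  have h2 : ¬ IsPositive P B (reflW P i • reflW P (w • l) • w • l) := by
    rw [smul_reflW_self, isPositive_reflW_self hB]
    intro h3
    exact h (hw.isPositive_inv hB (by
      intro h4
      exact h (hw.isPositive_inv hB (absurd h4 (by simpa using h3)))))
  have h3 := (isRay_of_reflW hB hi ((isPositive_reflW_self hB _).2 (hw l hl)) h2).reflW_eq
  rw [(isRay_reflW_self (w • l)).reflW_eq] at h3
  rw [mul_reflW, h3]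

end Length

/-! ### Dominant vectors, and recovering a chamber from norms. -/

section Dominant

variable {ι V N : Type*} {F : Subfield ℝ}
variable [AddCommGroup V] [Module F V] [AddCommGroup N] [Module F N]
variable {P : RootPairing ι F V N} {B : Finset ι} [Fintype ι] [P.IsRootSystem]

variable (P B) in
/-- All positive coroots are non-negative on `v`. -/
def IsDominant (v : V) : Prop := ∀ i, IsPositive P B i → 0 ≤ P.coroot' i v

open Classical in
variable (P B) in
/-- The norm on `V` corresponding to the distance of the model space. -/
def rootNorm (v : V) : F := ∑ i with IsPositive P B i, |P.coroot' i v|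

variable (P) in
theorem exists_regular (hB : IsRootBasis P B) :
    ∃ ρ : V, ∀ k, IsPositive P B k → 0 < P.coroot' k ρ := by
  obtain ⟨ω, hω⟩ := exists_fundWeight hB
  refine ⟨∑ j ∈ B, ω j, fun k hk => ?_⟩
  have h1 : ∀ i ∈ B, P.coroot' i (∑ j ∈ B, ω j) = 1 := by
    intro i hi
    rw [map_sum, Finset.sum_eq_single i]
    · rw [hω i hi i hi, if_pos rfl]
    · intro j hj hji; rw [hω i hi j hj, if_neg hji.symm]
    · intro h; exact absurd hi h
  obtain ⟨c, hc, h⟩ := exists_coroot'_eq_sum hk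
  have h2 : ∃ j ∈ B, 0 < c j := by
    by_contra hcon
    push Not at hcon
    have h3 : P.coroot' k (P.root k) = 0 := by
      rw [h, LinearMap.sum_apply]
      refine Finset.sum_eq_zero fun j hj => ?_
      rw [le_antisymm (hcon j hj) (hc j hj), zero_smul, LinearMap.zero_apply]
    rw [RootPairing.root_coroot'_eq_pairing, RootPairing.pairing_same] at h3
    exact two_ne_zero h3
  obtain ⟨j, hj, hcj⟩ := h2
  rw [h, LinearMap.sum_apply]
  refine Finset.sum_pos' (fun i hi => ?_) ⟨j, hj, ?_⟩
  · rw [LinearMap.smul_apply, h1 i hi, smul_eq_mul, mul_one]; exact hc i hi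
  · rw [LinearMap.smul_apply, h1 j hj, smul_eq_mul, mul_one]; exact hcj

/-- A generic vector on the panel of the fundamental chamber fixed by a simple reflection. -/
theorem exists_panel (hB : IsRootBasis P B) {i : ι} (hi : i ∈ B) :
    ∃ η : V, P.coroot' i η = 0 ∧
      ∀ k, IsPositive P B k → ¬ IsRay P i k → 0 < P.coroot' k η := by
  classical
  obtain ⟨ω, hω⟩ := exists_fundWeight hB
  have h1 : ∀ k ∈ B, P.coroot' k (∑ j ∈ B.erase i, ω j) = if k = i then 0 else 1 := by
    intro k hk
    rw [map_sum]
    split_ifs with hki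
    · refine Finset.sum_eq_zero fun j hj => ?_
      rw [hω k hk j (Finset.mem_of_mem_erase hj), if_neg]
      rw [hki]; exact (Finset.ne_of_mem_erase hj).symm
    · rw [Finset.sum_eq_single k]
      · rw [hω k hk k hk, if_pos rfl]
      · intro j hj hji; rw [hω k hk j (Finset.mem_of_mem_erase hj), if_neg hji.symm]
      · intro h; exact absurd (Finset.mem_erase.2 ⟨hki, hk⟩) h
  refine ⟨∑ j ∈ B.erase i, ω j, by rw [h1 i hi, if_pos rfl], fun k hk hr => ?_⟩
  obtain ⟨c, hc, h⟩ := hk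
  have h2 : ∃ j ∈ B, j ≠ i ∧ 0 < c j := by
    by_contra hcon
    push Not at hcon
    refine hr ⟨c i, ?_⟩
    rw [h]
    refine Finset.sum_eq_single i (fun j hj hji => ?_) (fun h => absurd hi h)
    rw [le_antisymm (hcon j hj hji) (hc j hj), zero_smul]
  obtain ⟨j, hj, hji, hcj⟩ := h2
  have hp := fun j => rootForm_self_pos (P := P) j
  rw [coroot'_eq_sum h, LinearMap.sum_apply]
  refine Finset.sum_pos' (fun l hl => ?_) ⟨j, hj, ?_⟩
  · rw [LinearMap.smul_apply, h1 l hl, smul_eq_mul]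
    refine mul_nonneg (div_nonneg (mul_nonneg (hc l hl) (hp l).le) (hp k).le) ?_
    split_ifs <;> norm_num
  · rw [LinearMap.smul_apply, h1 j hj, if_neg hji, smul_eq_mul, mul_one]
    exact div_pos (mul_pos hcj (hp j)) (hp k)

theorem coroot'_reflW_self (i : ι) (v : V) : P.coroot' (reflW P i • i) v = -P.coroot' i v := by
  have h := coroot'_of_root_eq_smul (P := P) (i := i) (k := reflW P i • i) (c := -1)
    (by rw [root_reflW_self, neg_one_smul])
  rw [← h, LinearMap.smul_apply, smul_eq_mul]
  ring

/-- A large multiple of a regular dominant vector outweighs `v` on every positive coroot. -/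
theorem exists_isDominant_sub (hB : IsRootBasis P B) (v : V) :
    ∃ x y, IsDominant P B x ∧ IsDominant P B y ∧ v = x - y := by
  obtain ⟨ρ, hρ⟩ := exists_regular P hB
  let c : F := ∑ k with 0 < P.coroot' k ρ, |P.coroot' k v| / P.coroot' k ρ
  have hc0 : ∀ k, 0 < P.coroot' k ρ → |P.coroot' k v| ≤ c * P.coroot' k ρ := by
    intro k hk
    rw [← div_le_iff₀ hk]
    exact Finset.single_le_sum (f := fun k => |P.coroot' k v| / P.coroot' k ρ)
      (fun j hj => div_nonneg (abs_nonneg _) (Finset.mem_filter.1 hj).2.le)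
      (Finset.mem_filter.2 ⟨Finset.mem_univ _, hk⟩)
  have hc : 0 ≤ c :=
    Finset.sum_nonneg fun j hj => div_nonneg (abs_nonneg _) (Finset.mem_filter.1 hj).2.le
  refine ⟨v + c • ρ, c • ρ, fun k hk => ?_, fun k hk => ?_, by abel⟩
  · rw [map_add, map_smul, smul_eq_mul]
    have h1 := hc0 k (hρ k hk)
    have h2 := neg_abs_le (P.coroot' k v)
    linarith
  · rw [map_smul, smul_eq_mul]
    exact mul_nonneg hc (hρ k hk).le

theorem weyl_ext_dominant (hB : IsRootBasis P B) {u w : P.weylGroup}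
    (h : ∀ v, IsDominant P B v → u • v = w • v) : u = w := by
  refine weyl_ext fun v => ?_
  obtain ⟨x, y, hx, hy, rfl⟩ := exists_isDominant_sub hB v
  rw [smul_sub, smul_sub, h x hx, h y hy]

open Classical in
-- For large `t` the sign of each positive coroot on `t • v - ζ` is decided by `v`, and by `-ζ`
-- where `v` vanishes. The correction term thus records which positive coroots are strictly positive
-- on `v`.
theorem rootNorm_smul_sub {v ζ : V} (hζ : IsDominant P B ζ) {t : F} (ht : 0 ≤ t)
    (h : ∀ k, 0 < P.coroot' k v → P.coroot' k ζ ≤ t * P.coroot' k v) :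
    rootNorm P B (t • v - ζ) = t * rootNorm P B v + ∑ k with IsPositive P B k, P.coroot' k ζ -
      2 * ∑ k with IsPositive P B k, if 0 < P.coroot' k v then P.coroot' k ζ else 0 := by
  rw [rootNorm, rootNorm, Finset.mul_sum, Finset.mul_sum, ← Finset.sum_add_distrib,
    ← Finset.sum_sub_distrib]
  refine Finset.sum_congr rfl fun k hk => ?_
  have h1 := hζ k (Finset.mem_filter.1 hk).2
  rw [map_sub, map_smul, smul_eq_mul]
  split_ifs with hv
  · rw [abs_of_nonneg (sub_nonneg.2 (h k hv)), abs_of_pos hv]; ring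
  · rw [abs_of_nonpos (not_lt.1 hv), abs_of_nonpos]
    · ring
    · have := mul_nonpos_of_nonneg_of_nonpos ht (not_lt.1 hv)
      linarith

theorem rootNorm_smul {t : F} (ht : 0 ≤ t) (v : V) :
    rootNorm P B (t • v) = t * rootNorm P B v := by
  simp only [rootNorm, map_smul, smul_eq_mul, abs_mul, abs_of_nonneg ht, Finset.mul_sum]

open Classical in
-- Comparing the expansions of `rootNorm_smul_sub` shows that the sums `S u` and `S v` over the
-- strictly positive coroots agree on dominant vectors, hence at `v`; maximality of `S v v` then
-- gives the claim.
theorem pos_of_rootNorm_sub_eq (hB : IsRootBasis P B) {u v : V}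
    (h : ∀ ζ, IsDominant P B ζ → rootNorm P B (u - ζ) = rootNorm P B (v - ζ))
    {k : ι} (hk : IsPositive P B k) (hv : 0 < P.coroot' k v) : 0 < P.coroot' k u := by
  let S : V → V → F := fun v ζ =>
    ∑ k with IsPositive P B k, if 0 < P.coroot' k v then P.coroot' k ζ else 0
  have h0 : rootNorm P B u = rootNorm P B v := by
    have := h 0 (fun i _ => by simp)
    simpa using this
  have h1 : ∀ ζ, IsDominant P B ζ → S u ζ = S v ζ := by
    intro ζ hζ
    let c : V → F := fun v => ∑ k, |P.coroot' k ζ| / |P.coroot' k v|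
    have hc : ∀ v, 0 ≤ c v := fun v =>
      Finset.sum_nonneg fun j _ => div_nonneg (abs_nonneg _) (abs_nonneg _)
    have hcv : ∀ v k, 0 < P.coroot' k v → P.coroot' k ζ ≤ c v * P.coroot' k v := by
      intro v k hk
      rw [← div_le_iff₀ hk]
      refine le_trans ?_ (Finset.single_le_sum (f := fun k => |P.coroot' k ζ| / |P.coroot' k v|)
        (fun j _ => div_nonneg (abs_nonneg _) (abs_nonneg _)) (Finset.mem_univ k))
      rw [abs_of_pos hk]
      exact div_le_div_of_nonneg_right (le_abs_self _) hk.le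
    let t : F := c u + c v + 1
    have ht : 0 < t := by have := hc u; have := hc v; positivity
    have htu : ∀ k, 0 < P.coroot' k u → P.coroot' k ζ ≤ t * P.coroot' k u := by
      intro k hk
      refine (hcv u k hk).trans (mul_le_mul_of_nonneg_right ?_ hk.le)
      have := hc v
      simp only [t]; linarith
    have htv : ∀ k, 0 < P.coroot' k v → P.coroot' k ζ ≤ t * P.coroot' k v := by
      intro k hk
      refine (hcv v k hk).trans (mul_le_mul_of_nonneg_right ?_ hk.le)
      have := hc u
      simp only [t]; linarith
    have h2 := rootNorm_smul_sub hζ ht.le htu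
    have h3 := rootNorm_smul_sub hζ ht.le htv
    -- The hypothesis concerns the unscaled vectors, so it is applied to the dominant vector `t⁻¹ •
    -- ζ`.
    have h4 : rootNorm P B (t • u - ζ) = rootNorm P B (t • v - ζ) := by
      have h5 : ∀ x : V, t • x - ζ = t • (x - t⁻¹ • ζ) := fun x => by
        rw [smul_sub, smul_inv_smul₀ ht.ne']
      rw [h5, h5, rootNorm_smul ht.le, rootNorm_smul ht.le, h]
      intro i hi
      rw [map_smul]
      exact mul_nonneg (inv_nonneg.2 ht.le) (hζ i hi)
    rw [h2, h3, h0] at h4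
    simp only [S]
    linarith
  have hS : ∀ v x y, S v (x - y) = S v x - S v y := by
    intro v x y
    simp only [S]
    rw [← Finset.sum_sub_distrib]
    refine Finset.sum_congr rfl fun k _ => ?_
    split_ifs
    · rw [map_sub]
    · rw [sub_zero]
  have h2 : S u v = S v v := by
    obtain ⟨x, y, hx, hy, hv⟩ := exists_isDominant_sub hB v
    have h3 : S u (x - y) = S v (x - y) := by rw [hS, hS, h1 x hx, h1 y hy]
    rwa [← hv] at h3
  -- `S v v` adds up exactly the positive values of coroots on `v`. Any other selection gives at
  -- most this, and strictly less if it omits `k`.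
  by_contra hu
  have h3 : S u v < S v v := by
    refine Finset.sum_lt_sum (fun j _ => ?_) ⟨k, Finset.mem_filter.2 ⟨Finset.mem_univ _, hk⟩, ?_⟩
    · split_ifs with h4 h5 h5
      · exact le_rfl
      · exact not_lt.1 h5
      · exact h5.le
      · exact le_rfl
    · rw [if_neg hu, if_pos hv]; exact hv
  exact h3.ne h2

theorem reflW_smul_eq_self {i : ι} {η : V} (h : P.coroot' i η = 0) : reflW P i • η = η := by
  rw [reflW_smul, h, zero_smul, sub_zero]

/-- The vector `η` vanishes only on coroots of multiples of `i`. As `w` makes `i` negative, no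
positive `k` comes from a positive multiple of `i`, so the signs on `w • η` are those of `w⁻¹ • k`
up to zeros on the negative side. -/
theorem coroot'_panel_pos_iff (hB : IsRootBasis P B) {i : ι} (hi : i ∈ B) {η : V}
    (hη : P.coroot' i η = 0) (hη' : ∀ k, IsPositive P B k → ¬ IsRay P i k → 0 < P.coroot' k η)
    {w : P.weylGroup} (hw : ¬ IsPositive P B (w • i)) {k : ι} (hk : IsPositive P B k) :
    0 < P.coroot' k (w • η) ↔ IsPositive P B (w⁻¹ • k) := by
  rw [coroot'_smul']
  constructor
  · intro h
    by_contra hn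
    rw [← isPositive_reflW_self hB] at hn
    have h1 : P.coroot' (reflW P (w⁻¹ • k) • w⁻¹ • k) η < 0 := by
      rw [coroot'_reflW_self]; linarith
    by_cases hr : IsRay P i (reflW P (w⁻¹ • k) • w⁻¹ • k)
    · obtain ⟨c, hc⟩ := hr
      have h2 := coroot'_of_root_eq_smul hc
      rw [← h2, LinearMap.smul_apply, smul_eq_mul] at hη
      rcases mul_eq_zero.1 hη with h3 | h3
      · rw [h3, zero_smul] at hc; exact P.ne_zero _ hc
      · exact h1.ne h3
    · exact absurd (hη' _ hn hr) (not_lt.2 h1.le)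
  · intro h
    refine hη' _ h fun hr => hw ?_
    rw [← hr.isPositive_smul hB (isPositive_of_mem hi) h w, smul_inv_smul]
    exact hk

/-- Distances from the fundamental chamber to a generic point of a panel of a chamber determine
the chamber up to reflection in the panel. -/
theorem eq_or_eq_mul_reflW (hB : IsRootBasis P B) {i : ι} (hi : i ∈ B) {η : V}
    (hη : P.coroot' i η = 0) (hη' : ∀ k, IsPositive P B k → ¬ IsRay P i k → 0 < P.coroot' k η)
    {u w : P.weylGroup}
    (h : ∀ ζ, IsDominant P B ζ → rootNorm P B (u • η - ζ) = rootNorm P B (w • η - ζ)) :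
    w = u ∨ w = u * reflW P i := by
  have key : ∀ u : P.weylGroup, ∃ v, (v = u ∨ v = u * reflW P i) ∧ v • η = u • η ∧
      ¬ IsPositive P B (v • i) := by
    intro u
    by_cases hu : IsPositive P B (u • i)
    · refine ⟨u * reflW P i, Or.inr rfl, by rw [mul_smul, reflW_smul_eq_self hη], ?_⟩
      rw [mul_smul, smul_reflW_self, isPositive_reflW_self hB]
      exact not_not.2 hu
    · exact ⟨u, Or.inl rfl, rfl, hu⟩
  obtain ⟨u', hu', huη, hui⟩ := key u
  obtain ⟨w', hw', hwη, hwi⟩ := key w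
  rw [← huη, ← hwη] at h
  have h1 : ∀ k, IsPositive P B k →
      (IsPositive P B (u'⁻¹ • k) ↔ IsPositive P B (w'⁻¹ • k)) := by
    intro k hk
    rw [← coroot'_panel_pos_iff hB hi hη hη' hui hk, ← coroot'_panel_pos_iff hB hi hη hη' hwi hk]
    exact ⟨pos_of_rootNorm_sub_eq hB (fun ζ hζ => (h ζ hζ).symm) hk,
      pos_of_rootNorm_sub_eq hB h hk⟩
  have h2 : u' = w' := by
    refine eq_of_isPositive_iff hB fun k => ?_
    by_cases hk : IsPositive P B k
    · exact (h1 k hk).1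
    · have h3 := h1 _ ((isPositive_reflW_self hB k).2 hk)
      rw [smul_reflW_self, smul_reflW_self, isPositive_reflW_self hB,
        isPositive_reflW_self hB, not_iff_not] at h3
      exact h3.1
  subst h2
  have h3 : ∀ a b : P.weylGroup, a = b * reflW P i → b = a * reflW P i := by
    rintro a b rfl
    rw [mul_assoc, reflW_mul_self, mul_one]
  rcases hu' with rfl | h4 <;> rcases hw' with h5 | h5
  · exact Or.inl h5.symm
  · exact Or.inr (h3 _ _ h5)
  · exact Or.inr (h5 ▸ h4)
  · exact Or.inl (mul_right_cancel (h5.symm.trans h4))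

end Dominant

/-! ### Transfer to the model space: sectors, germs, a fundamental domain. -/

section ModelSpace

variable {ι V N Λ : Type*} {F : Subfield ℝ}
variable [AddCommGroup V] [Module F V] [AddCommGroup N] [Module F N]
variable [AddCommGroup Λ] [LinearOrder Λ] [IsOrderedAddMonoid Λ] [Module F Λ]
variable {P : RootPairing ι F V N} {B : Finset ι}

theorem smul_tmul_weyl (w : P.weylGroup) (v : V) (c : Λ) : w • (v ⊗ₜ[F] c) = (w • v) ⊗ₜ[F] c :=
  rfl

theorem refl_eq_smul (i : ι) (x : V ⊗[F] Λ) : refl Λ P i x = reflW P i • x := by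
  induction x using TensorProduct.induction_on with
  | zero => rw [map_zero, smul_zero]
  | tmul v c => rfl
  | add x y hx hy => rw [map_add, smul_add, hx, hy]

theorem coEval_smul (w : P.weylGroup) (i : ι) (x : V ⊗[F] Λ) :
    coEval Λ P (w • i) (w • x) = coEval Λ P i x := by
  induction x using TensorProduct.induction_on with
  | zero => rw [smul_zero, map_zero, map_zero]
  | tmul v c => rw [smul_tmul_weyl, coEval_tmul, coEval_tmul, coroot'_smul]
  | add x y hx hy => rw [smul_add, map_add, map_add, hx, hy]

theorem coEval_smul' (w : P.weylGroup) (i : ι) (x : V ⊗[F] Λ) :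
    coEval Λ P i (w • x) = coEval Λ P (w⁻¹ • i) x := by
  rw [← coEval_smul w (w⁻¹ • i), smul_inv_smul]

theorem exists_weyl_of_mem {w : (V ⊗[F] Λ) ≃ₗ[F] (V ⊗[F] Λ)} (hw : w ∈ sphericalWeyl Λ P) :
    ∃ u : P.weylGroup, ∀ x, w x = u • x := by
  induction hw using Subgroup.closure_induction with
  | mem w hw => obtain ⟨i, rfl⟩ := hw; exact ⟨reflW P i, refl_eq_smul i⟩
  | one => exact ⟨1, fun x => (one_smul _ x).symm⟩
  | mul a b _ _ ha hb =>
    obtain ⟨u, hu⟩ := ha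
    obtain ⟨v, hv⟩ := hb
    exact ⟨u * v, fun x => by rw [mul_smul, ← hv, ← hu]; rfl⟩
  | inv a _ ha =>
    obtain ⟨u, hu⟩ := ha
    refine ⟨u⁻¹, fun x => ?_⟩
    rw [eq_inv_smul_iff, ← hu]
    exact a.apply_symm_apply x

variable (Λ) in
theorem exists_mem_of_weyl (u : P.weylGroup) :
    ∃ w ∈ sphericalWeyl Λ P, ∀ x : V ⊗[F] Λ, w x = u • x := by
  induction u using weylGroup_induction with
  | refl i => exact ⟨refl Λ P i, Subgroup.subset_closure ⟨i, rfl⟩, refl_eq_smul i⟩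
  | one => exact ⟨1, one_mem _, fun x => (one_smul _ x).symm⟩
  | mul u v hu hv =>
    obtain ⟨a, ha, hau⟩ := hu
    obtain ⟨b, hb, hbv⟩ := hv
    exact ⟨a * b, mul_mem ha hb, fun x => by rw [mul_smul, ← hbv, ← hau]; rfl⟩

theorem mem_affineWeyl_iff {T : AddSubgroup (V ⊗[F] Λ)} {g : V ⊗[F] Λ → V ⊗[F] Λ} :
    g ∈ affineWeyl P T ↔ ∃ u : P.weylGroup, ∃ t ∈ T, g = fun x => u • x + t := by
  constructor
  · rintro ⟨w, hw, t, ht, rfl⟩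
    obtain ⟨u, hu⟩ := exists_weyl_of_mem hw
    exact ⟨u, t, ht, funext fun x => by rw [hu]⟩
  · rintro ⟨u, t, ht, rfl⟩
    obtain ⟨w, hw, h⟩ := exists_mem_of_weyl Λ u
    exact ⟨w, hw, t, ht, funext fun x => by rw [h]⟩

theorem coEval_reflW_self (i : ι) (x : V ⊗[F] Λ) :
    coEval Λ P (reflW P i • i) x = -coEval Λ P i x :=
  coEval_reflectionPerm_self i x

theorem zero_mem_fundChamber : (0 : V ⊗[F] Λ) ∈ fundChamber Λ P B :=
  fun i _ => by rw [map_zero]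

theorem add_mem_fundChamber {x y : V ⊗[F] Λ} (hx : x ∈ fundChamber Λ P B)
    (hy : y ∈ fundChamber Λ P B) : x + y ∈ fundChamber Λ P B :=
  fun i hi => by rw [map_add]; exact add_nonneg (hx i hi) (hy i hi)

variable [Fintype ι] [P.IsRootSystem]

theorem coEval_of_coroot'_smul {i k : ι} {c : F} (h : c • P.coroot' k = P.coroot' i)
    (x : V ⊗[F] Λ) : c • coEval Λ P k x = coEval Λ P i x := by
  induction x using TensorProduct.induction_on with
  | zero => rw [map_zero, map_zero, smul_zero]
  | tmul v c => rw [coEval_tmul, coEval_tmul, ← h, LinearMap.smul_apply, smul_assoc]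
  | add x y hx hy => rw [map_add, map_add, smul_add, hx, hy]

theorem coEval_nonpos_of_not_isPositive (hB : IsRootBasis P B) {i : ι}
    (hi : ¬ IsPositive P B i) {x : V ⊗[F] Λ} (hx : x ∈ fundChamber Λ P B) :
    coEval Λ P i x ≤ 0 := by
  have h := hx _ ((isPositive_reflW_self hB i).2 hi)
  rw [coEval_reflW_self] at h
  exact neg_nonneg.1 h

theorem modelDist_self (x : V ⊗[F] Λ) : modelDist P B x x = 0 := by
  simp [modelDist]

theorem modelDist_comm (x y : V ⊗[F] Λ) : modelDist P B x y = modelDist P B y x := by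
  refine Finset.sum_congr rfl fun i _ => ?_
  rw [← neg_sub, map_neg, abs_neg]

theorem modelDist_triangle (x y z : V ⊗[F] Λ) :
    modelDist P B x z ≤ modelDist P B x y + modelDist P B y z := by
  rw [modelDist, modelDist, modelDist, ← Finset.sum_add_distrib]
  refine Finset.sum_le_sum fun i _ => ?_
  have h : z - x = (y - x) + (z - y) := by abel
  rw [h, map_add]
  exact abs_add_le _ _

theorem modelDist_smul_add (hB : IsRootBasis P B) (u : P.weylGroup) (t x y : V ⊗[F] Λ) :
    modelDist P B (u • x + t) (u • y + t) = modelDist P B x y :=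
  modelDist_affineWeyl hB (T := ⊤)
    (mem_affineWeyl_iff.2 ⟨u, t, AddSubgroup.mem_top _, rfl⟩) x y

variable [IsOrderedModule F Λ]

/-- Although Λ may be non-archimedean, positive scalars of `F` are invertible on it; the sum of the
finitely many rescaled bounds serves as `μ`. -/
theorem exists_le_smul {s : ι → F} (c : ι → Λ) :
    ∃ μ : Λ, 0 ≤ μ ∧ ∀ k, 0 < s k → c k ≤ s k • μ := by
  classical
  refine ⟨∑ k with 0 < s k, (s k)⁻¹ • |c k|, ?_, fun k hk => ?_⟩
  · exact Finset.sum_nonneg fun k hk =>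
      smul_nonneg (inv_nonneg.2 (Finset.mem_filter.1 hk).2.le) (abs_nonneg _)
  · have h1 : (s k)⁻¹ • |c k| ≤ ∑ k with 0 < s k, (s k)⁻¹ • |c k| :=
      Finset.single_le_sum (f := fun k => (s k)⁻¹ • |c k|)
        (fun k hk => smul_nonneg (inv_nonneg.2 (Finset.mem_filter.1 hk).2.le) (abs_nonneg _))
        (Finset.mem_filter.2 ⟨Finset.mem_univ _, hk⟩)
    have h2 := smul_le_smul_of_nonneg_left h1 hk.le
    rw [smul_inv_smul₀ hk.ne'] at h2
    exact (le_abs_self _).trans h2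

/-- Any two sectors of the same direction have a common subsector. -/
theorem exists_sub_mem_fundChamber (hB : IsRootBasis P B) (a b : V ⊗[F] Λ) :
    ∃ c, c - a ∈ fundChamber Λ P B ∧ c - b ∈ fundChamber Λ P B := by
  obtain ⟨ρ, hρ⟩ := exists_regular P hB
  obtain ⟨μ, hμ, h⟩ := exists_le_smul (s := fun k => P.coroot' k ρ)
    (fun k => coEval Λ P k (b - a))
  refine ⟨a + ρ ⊗ₜ μ, fun k hk => ?_, fun k hk => ?_⟩
  · rw [add_sub_cancel_left, coEval_tmul]
    exact smul_nonneg (hρ k hk).le hμ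
  · have h1 : a + ρ ⊗ₜ μ - b = ρ ⊗ₜ μ - (b - a) := by abel
    rw [h1, map_sub, coEval_tmul]
    exact sub_nonneg.2 (h k (hρ k hk))

theorem tmul_mem_fundChamber {v : V} (hv : IsDominant P B v) {μ : Λ} (hμ : 0 ≤ μ) :
    v ⊗ₜ[F] μ ∈ fundChamber Λ P B := fun i hi => by
  rw [coEval_tmul]
  exact smul_nonneg (hv i hi) hμ

/-- Along a regular direction of the chamber a negative root is unbounded below. So a half-apartment
containing a sector must be bounded by a root that is positive for it. -/
theorem isPositive_of_le_coEval [Nontrivial Λ] (hB : IsRootBasis P B) {j : ι} {c : Λ}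
    (h : ∀ x ∈ fundChamber Λ P B, c ≤ coEval Λ P j x) : IsPositive P B j := by
  by_contra hn
  obtain ⟨ρ, hρ⟩ := exists_regular P hB
  have h1 := hρ _ ((isPositive_reflW_self hB j).2 hn)
  rw [coroot'_reflW_self] at h1
  obtain ⟨ε, hε⟩ := exists_zero_lt (α := Λ)
  obtain ⟨μ, hμ, h2⟩ := exists_le_smul (ι := ι) (s := fun _ => -P.coroot' j ρ) (fun _ => ε - c)
  have h3 := h2 j h1
  have h4 := h _ (tmul_mem_fundChamber (fun i hi => (hρ i hi).le) hμ)
  rw [coEval_tmul] at h4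
  rw [neg_smul] at h3
  have h5 : ε - c ≤ -c := h3.trans (neg_le_neg h4)
  have h6 : ε ≤ 0 := by
    have := add_le_add_left h5 c
    simpa using this
  exact absurd hε (not_lt.2 h6)

theorem isPositive_of_le_coEval_add_smul [Nontrivial Λ] (hB : IsRootBasis P B) {j : ι} {c : Λ}
    (a : V ⊗[F] Λ) (w : P.weylGroup)
    (h : ∀ x ∈ fundChamber Λ P B, c ≤ coEval Λ P j (a + w • x)) : IsPositive P B (w⁻¹ • j) := by
  refine isPositive_of_le_coEval (c := c - coEval Λ P j a) hB fun x hx => ?_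
  have h1 := h x hx
  rw [map_add, coEval_smul'] at h1
  exact sub_le_iff_le_add'.2 h1

theorem smul_pos_of_pos {c : F} {x : Λ} (hc : 0 < c) (hx : 0 < x) : 0 < c • x := by
  refine lt_of_le_of_ne (smul_nonneg hc.le hx.le) fun h => hx.ne' ?_
  rw [← inv_smul_smul₀ hc.ne' x, ← h, smul_zero]

/-- Dominant vectors have small multiples in the model space. -/
theorem exists_small_tmul (v : V) {ε : Λ} (hε : 0 < ε) :
    ∃ μ : Λ, 0 < μ ∧ ∀ i, coEval Λ P i (v ⊗ₜ[F] μ) < ε := by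
  let s : F := 1 + ∑ i, |P.coroot' i v|
  have hs : 0 < s := by
    have : 0 ≤ ∑ i, |P.coroot' i v| := Finset.sum_nonneg fun i _ => abs_nonneg _
    simp only [s]; linarith
  refine ⟨s⁻¹ • ε, smul_pos_of_pos (inv_pos.2 hs) hε, fun i => ?_⟩
  rw [coEval_tmul, smul_smul]
  have h1 : P.coroot' i v < s := by
    have h2 := Finset.single_le_sum (f := fun i => |P.coroot' i v|)
      (fun j _ => abs_nonneg _) (Finset.mem_univ i)
    have h3 := le_abs_self (P.coroot' i v)
    simp only [s]; linarith
  have h2 : 0 < 1 - P.coroot' i v * s⁻¹ := by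
    have : P.coroot' i v * s⁻¹ < 1 := by
      rw [← div_eq_mul_inv, div_lt_one hs]; exact h1
    linarith
  have h3 := smul_pos_of_pos h2 hε
  rw [sub_smul, one_smul] at h3
  exact sub_pos.1 h3

/-- An element of the affine Weyl group is determined by its restriction to the germ of a
sector. -/
theorem weyl_affine_ext (hB : IsRootBasis P B) {u u' : P.weylGroup} {t t' a : V ⊗[F] Λ} {ε : Λ}
    (hε : 0 < ε) (h : ∀ x ∈ fundChamber Λ P B, (∀ i, coEval Λ P i x < ε) →
      u • (a + x) + t = u' • (a + x) + t') : u = u' ∧ t = t' := by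
  have h0 := h 0 zero_mem_fundChamber (fun i => by rw [map_zero]; exact hε)
  rw [add_zero] at h0
  have h1 : u = u' := by
    refine weyl_ext_dominant hB fun v hv => ?_
    obtain ⟨μ, hμ, hsm⟩ := exists_small_tmul (P := P) v hε
    have h2 := h _ (tmul_mem_fundChamber hv hμ.le) hsm
    have h3 : u • (v ⊗ₜ[F] μ) = u' • (v ⊗ₜ[F] μ) := by
      rw [smul_add, smul_add, add_right_comm, h0, add_right_comm] at h2
      exact add_left_cancel (add_right_cancel h2)
    rw [smul_tmul_weyl, smul_tmul_weyl] at h3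
    rw [← sub_eq_zero]
    refine eq_zero_of_coroot' (P := P) fun i => ?_
    have h4 := congrArg (coEval Λ P i) h3
    rw [coEval_tmul, coEval_tmul, ← sub_eq_zero, ← sub_smul] at h4
    rw [map_sub]
    by_contra h5
    exact hμ.ne' ((smul_eq_zero_iff_right h5).1 h4)
  subst h1
  exact ⟨rfl, add_left_cancel h0⟩

theorem weyl_affine_ext_sector [Nontrivial Λ] (hB : IsRootBasis P B) {u u' : P.weylGroup}
    {t t' a : V ⊗[F] Λ} (h : ∀ x ∈ fundChamber Λ P B, u • (a + x) + t = u' • (a + x) + t') :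
    u = u' ∧ t = t' := by
  obtain ⟨ε, hε⟩ := exists_zero_lt (α := Λ)
  exact weyl_affine_ext hB hε fun x hx _ => h x hx

/-- The fundamental chamber is a fundamental domain. -/
theorem exists_smul_mem_fundChamber (hB : IsRootBasis P B) (x : V ⊗[F] Λ) :
    ∃ w : P.weylGroup, w • x ∈ fundChamber Λ P B := by
  classical
  -- Minimise the number of positive roots that are negative on `w • x`. If a simple root `i` were
  -- among them, reflecting would inject the new bad set into the old one with `i` removed.
  let n : P.weylGroup → ℕ := fun w =>
    (Finset.univ.filter fun k => IsPositive P B k ∧ coEval Λ P k (w • x) < 0).card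
  obtain ⟨w, hw⟩ := Finite.exists_min n
  have hsimple : ∀ i ∈ B, 0 ≤ coEval Λ P i (w • x) := by
    intro i hi
    by_contra hneg
    rw [not_le] at hneg
    have hip := isPositive_of_mem (P := P) hi
    refine absurd (hw (reflW P i * w)) (not_le.2 ?_)
    refine lt_of_le_of_lt (Finset.card_le_card_of_injOn (fun k => reflW P i • k)
      (t := (Finset.univ.filter fun k => IsPositive P B k ∧ coEval Λ P k (w • x) < 0).erase i)
      ?_ ?_) (Finset.card_erase_lt_of_mem ?_)
    · intro k hk
      simp only [Finset.coe_filter, Finset.mem_univ, true_and, Set.mem_ofPred_eq,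
        Finset.coe_erase, Set.mem_sdiff, Set.mem_singleton_iff] at hk ⊢
      obtain ⟨hk, hkx⟩ := hk
      rw [mul_smul, coEval_smul', reflW_inv] at hkx
      have hr : ¬ IsRay P i k := by
        rintro ⟨c, hc⟩
        have hc0 := (isPositive_of_isRay hB hc hip).1 hk
        have h1 : P.root (reflW P i • k) = (-c) • P.root i := by
          rw [root_smul, hc, smul_comm, ← root_smul, root_reflW_self, smul_neg, neg_smul]
        have h2 := coEval_of_coroot'_smul (coroot'_of_root_eq_smul h1) (w • x)
        have h3 := smul_pos_of_pos hc0 (neg_pos.2 hkx)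
        rw [smul_neg, ← neg_smul, h2] at h3
        exact absurd h3 (not_lt.2 hneg.le)
      refine ⟨⟨isPositive_reflW_of_not_isRay hB hi hk hr, hkx⟩, fun h => hr ?_⟩
      refine ⟨-1, ?_⟩
      have h2 : k = reflW P i • i := by
        have := congrArg (fun j => reflW P i • j) h
        simpa only [reflW_reflW_smul] using this
      rw [h2, root_reflW_self, neg_one_smul]
    · exact fun a _ b _ h => MulAction.injective _ h
    · exact Finset.mem_filter.2 ⟨Finset.mem_univ _, hip, hneg⟩
  refine ⟨w, fun k hk => ?_⟩
  obtain ⟨c, hc, h⟩ := exists_coroot'_eq_sum hk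
  have h1 : ∀ y : V ⊗[F] Λ, coEval Λ P k y = ∑ j ∈ B, c j • coEval Λ P j y := by
    intro y
    induction y using TensorProduct.induction_on with
    | zero => simp
    | tmul v l =>
      simp only [coEval_tmul, h, LinearMap.sum_apply, LinearMap.smul_apply, Finset.sum_smul,
        smul_assoc]
    | add y z hy hz => simp only [map_add, hy, hz, smul_add, Finset.sum_add_distrib]
  rw [h1]
  exact Finset.sum_nonneg fun j hj => smul_nonneg (hc j hj) (hsimple j hj)

theorem modelDist_add_tmul (p : V ⊗[F] Λ) (v : V) {μ : Λ} (hμ : 0 ≤ μ) :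
    modelDist P B p (p + v ⊗ₜ[F] μ) = rootNorm P B v • μ := by
  rw [modelDist, rootNorm, Finset.sum_smul]
  refine Finset.sum_congr rfl fun i _ => ?_
  rw [add_sub_cancel_left, coEval_tmul]
  rcases le_total 0 (P.coroot' i v) with h | h
  · rw [abs_of_nonneg h, abs_of_nonneg (smul_nonneg h hμ)]
  · rw [abs_of_nonpos h, abs_of_nonpos (smul_nonpos_of_nonpos_of_nonneg h hμ), neg_smul]

open Classical in
-- The expansion in fundamental weights splits a displacement into pure tensors. For points of the
-- fundamental chamber each summand is a dominant step with a non-negative parameter in Λ.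
theorem exists_eq_sum_tmul (hB : IsRootBasis P B) :
    ∃ ω : ι → V, (∀ j ∈ B, IsDominant P B (ω j)) ∧
      ∀ x : V ⊗[F] Λ, x = ∑ j ∈ B, ω j ⊗ₜ[F] coEval Λ P j x := by
  obtain ⟨ω, hω⟩ := exists_fundWeight hB
  have h1 : ∀ v, v = ∑ j ∈ B, P.coroot' j v • ω j := by
    intro v
    rw [← sub_eq_zero]
    have hpos : ∀ i, IsPositive P B i → P.coroot' i (v - ∑ j ∈ B, P.coroot' j v • ω j) = 0 := by
      intro i hi
      obtain ⟨c, -, h⟩ := exists_coroot'_eq_sum hi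
      rw [h, LinearMap.sum_apply]
      refine Finset.sum_eq_zero fun k hk => ?_
      rw [LinearMap.smul_apply, map_sub, map_sum, Finset.sum_eq_single k]
      · rw [map_smul, hω k hk k hk, if_pos rfl]
        simp
      · intro j hj hjk
        rw [map_smul, hω k hk j hj, if_neg hjk.symm, smul_zero]
      · intro h; exact absurd hk h
    refine eq_zero_of_coroot' (P := P) fun i => ?_
    by_cases hi : IsPositive P B i
    · exact hpos i hi
    · have h2 := hpos _ ((isPositive_reflW_self hB i).2 hi)
      rwa [coroot'_reflW_self, neg_eq_zero] at h2
  refine ⟨ω, fun j hj i hi => ?_, fun x => ?_⟩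
  · obtain ⟨c, hc, h⟩ := exists_coroot'_eq_sum hi
    rw [h, LinearMap.sum_apply]
    refine Finset.sum_nonneg fun k hk => ?_
    rw [LinearMap.smul_apply, hω k hk j hj, smul_eq_mul]
    refine mul_nonneg (hc k hk) ?_
    split_ifs <;> norm_num
  · induction x using TensorProduct.induction_on with
    | zero => simp
    | tmul v c =>
      conv_lhs => rw [h1 v]
      rw [TensorProduct.sum_tmul]
      refine Finset.sum_congr rfl fun j _ => ?_
      rw [coEval_tmul, TensorProduct.smul_tmul]
    | add x y hx hy =>
      simp only [map_add, TensorProduct.tmul_add, Finset.sum_add_distrib]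
      rw [← hx, ← hy]

end ModelSpace

/-! ### Chambers at infinity and their Weyl-valued distance. -/

section Infinity

variable {ι V N Λ X : Type*} {F : Subfield ℝ}
variable [AddCommGroup V] [Module F V] [AddCommGroup N] [Module F N]
variable [AddCommGroup Λ] [LinearOrder Λ] [IsOrderedAddMonoid Λ] [Module F Λ]
variable {P : RootPairing ι F V N} {B : Finset ι}
variable {T : AddSubgroup (V ⊗[F] Λ)} {𝒜 : Set (V ⊗[F] Λ → X)}

/-- The chart `f` precomposed with an element of the Weyl group. -/
def rot (f : V ⊗[F] Λ → X) (u : P.weylGroup) : V ⊗[F] Λ → X := fun x => f (u • x)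

/-- The chart `f` precomposed with a translation. -/
def shift (f : V ⊗[F] Λ → X) (t : V ⊗[F] Λ) : V ⊗[F] Λ → X := fun x => f (x + t)

theorem rot_apply (f : V ⊗[F] Λ → X) (u : P.weylGroup) (x : V ⊗[F] Λ) : rot f u x = f (u • x) :=
  rfl

theorem shift_apply (f : V ⊗[F] Λ → X) (t x : V ⊗[F] Λ) : shift f t x = f (x + t) := rfl

theorem rot_rot (f : V ⊗[F] Λ → X) (u v : P.weylGroup) : rot (rot f u) v = rot f (u * v) :=
  funext fun x => by rw [rot_apply, rot_apply, rot_apply, mul_smul]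

theorem rot_one (f : V ⊗[F] Λ → X) : rot f (1 : P.weylGroup) = f :=
  funext fun x => by rw [rot_apply, one_smul]

theorem range_rot (f : V ⊗[F] Λ → X) (u : P.weylGroup) : Set.range (rot f u) = Set.range f :=
  (MulAction.surjective u).range_comp f

theorem range_shift (f : V ⊗[F] Λ → X) (t : V ⊗[F] Λ) : Set.range (shift f t) = Set.range f :=
  (Equiv.addRight t).surjective.range_comp f

variable (P B) in
/-- The sectors of the charts `f` and `g` have a common subsector, as parametrized sectors:
`f` and `g` define the same chamber at infinity. -/
def Asym (f g : V ⊗[F] Λ → X) : Prop :=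
  ∃ a b, ∀ x ∈ fundChamber Λ P B, f (a + x) = g (b + x)

theorem Asym.refl (f : V ⊗[F] Λ → X) : Asym P B f f := ⟨0, 0, fun _ _ => rfl⟩

theorem Asym.symm {f g : V ⊗[F] Λ → X} (h : Asym P B f g) : Asym P B g f := by
  obtain ⟨a, b, h⟩ := h
  exact ⟨b, a, fun x hx => (h x hx).symm⟩

theorem asym_shift (f : V ⊗[F] Λ → X) (t : V ⊗[F] Λ) (u : P.weylGroup) :
    Asym P B (rot (shift f t) u) (rot f u) := by
  refine ⟨0, u⁻¹ • t, fun x _ => ?_⟩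
  rw [rot_apply, rot_apply, shift_apply, smul_add u, smul_add u, smul_zero, smul_inv_smul,
    zero_add, add_comm]

variable (P B 𝒜) in
/-- The Weyl distance between the chambers at infinity of `f` and `g` is `w`. -/
def Dist (f g : V ⊗[F] Λ → X) (w : P.weylGroup) : Prop :=
  ∃ h ∈ 𝒜, Asym P B f h ∧ Asym P B g (rot h w)

variable [Fintype ι]

theorem rot_mem (hX : IsBuildingWithoutA5 P B T 𝒜) {f : V ⊗[F] Λ → X} (hf : f ∈ 𝒜)
    (u : P.weylGroup) : rot f u ∈ 𝒜 :=
  hX.A1 f hf _ (mem_affineWeyl_iff.2 ⟨u, 0, T.zero_mem, funext fun _ => (add_zero _).symm⟩)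

theorem shift_mem (hX : IsBuildingWithoutA5 P B T 𝒜) {f : V ⊗[F] Λ → X} (hf : f ∈ 𝒜)
    {t : V ⊗[F] Λ} (ht : t ∈ T) : shift f t ∈ 𝒜 :=
  hX.A1 f hf _ (mem_affineWeyl_iff.2 ⟨1, t, ht, funext fun x => by rw [one_smul]⟩)

theorem exists_finset_of_isWTConvex {Y : Set (V ⊗[F] Λ)} (h : IsWTConvex P T Y) :
    ∃ J : Finset (ι × Λ), Y = {x | ∀ p ∈ J, p.2 ≤ coEval Λ P p.1 x} := by
  classical
  obtain ⟨S, hS, hH, rfl⟩ := h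
  choose i c _ hc using hH
  refine ⟨hS.toFinset.attach.image fun H =>
    (i H.1 (hS.mem_toFinset.1 H.2), c H.1 (hS.mem_toFinset.1 H.2)), ?_⟩
  ext x
  simp only [Set.mem_sInter, Set.mem_ofPred_eq, Finset.mem_image]
  constructor
  · rintro h _ ⟨⟨H, hHS⟩, -, rfl⟩
    have h1 := h H (hS.mem_toFinset.1 hHS)
    rw [hc H (hS.mem_toFinset.1 hHS)] at h1
    exact h1
  · intro h H hHS
    rw [hc H hHS]
    exact h _ ⟨⟨H, hS.mem_toFinset.2 hHS⟩, Finset.mem_attach _ _, rfl⟩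

/-- Transition maps between charts whose apartments meet. -/
theorem exists_transition (hX : IsBuildingWithoutA5 P B T 𝒜) {f g : V ⊗[F] Λ → X} (hf : f ∈ 𝒜)
    (hg : g ∈ 𝒜) {x y : V ⊗[F] Λ} (hxy : f x = g y) :
    ∃ (J : Finset (ι × Λ)) (u : P.weylGroup) (t : V ⊗[F] Λ), t ∈ T ∧
      (∀ x, f x ∈ Set.range g ↔ ∀ p ∈ J, p.2 ≤ coEval Λ P p.1 x) ∧
      ∀ x, f x ∈ Set.range g → f x = g (u • x + t) := by
  obtain ⟨-, h1, w, hw, h2⟩ := hX.A2 f hf g hg ⟨f x, ⟨x, rfl⟩, ⟨y, hxy.symm⟩⟩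
  obtain ⟨J, hJ⟩ := exists_finset_of_isWTConvex h1
  obtain ⟨u, t, ht, rfl⟩ := mem_affineWeyl_iff.1 hw
  refine ⟨J, u, t, ht, fun x => ?_, fun x hx => h2 hx⟩
  have := Set.ext_iff.1 hJ x
  exact this

variable [P.IsRootSystem] [IsOrderedModule F Λ]

theorem Asym.trans (hB : IsRootBasis P B) {f g h : V ⊗[F] Λ → X} (h1 : Asym P B f g)
    (h2 : Asym P B g h) : Asym P B f h := by
  obtain ⟨a, b, h1⟩ := h1
  obtain ⟨b', c, h2⟩ := h2
  obtain ⟨d, hd, hd'⟩ := exists_sub_mem_fundChamber hB b b'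
  refine ⟨a + (d - b), c + (d - b'), fun x hx => ?_⟩
  have h3 := h1 _ (add_mem_fundChamber hd hx)
  have h4 := h2 _ (add_mem_fundChamber hd' hx)
  rw [add_assoc, h3, add_assoc, ← h4, ← add_assoc, ← add_assoc, add_sub_cancel, add_sub_cancel]

theorem Dist.congr (hB : IsRootBasis P B) {f f' g g' : V ⊗[F] Λ → X} {w : P.weylGroup}
    (h : Dist P B 𝒜 f g w) (hf : Asym P B f f') (hg : Asym P B g g') : Dist P B 𝒜 f' g' w := by
  obtain ⟨h, hh, h1, h2⟩ := h
  exact ⟨h, hh, hf.symm.trans hB h1, hg.symm.trans hB h2⟩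

theorem Dist.asym (hB : IsRootBasis P B) {f g : V ⊗[F] Λ → X} (h : Dist P B 𝒜 f g 1) :
    Asym P B f g := by
  obtain ⟨h, hh, h1, h2⟩ := h
  rw [rot_one] at h2
  exact h1.trans hB h2.symm

theorem Asym.dist {f g : V ⊗[F] Λ → X} (hf : f ∈ 𝒜) (h : Asym P B f g) : Dist P B 𝒜 f g 1 :=
  ⟨f, hf, Asym.refl f, by rw [rot_one]; exact h.symm⟩

theorem Dist.symm (hX : IsBuildingWithoutA5 P B T 𝒜) {f g : V ⊗[F] Λ → X} {w : P.weylGroup}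
    (h : Dist P B 𝒜 f g w) : Dist P B 𝒜 g f w⁻¹ := by
  obtain ⟨h, hh, h1, h2⟩ := h
  exact ⟨rot h w, rot_mem hX hh w, h2, by rw [rot_rot, mul_inv_cancel, rot_one]; exact h1⟩

theorem dist_rot {f : V ⊗[F] Λ → X} (hf : f ∈ 𝒜) (w : P.weylGroup) :
    Dist P B 𝒜 f (rot f w) w := ⟨f, hf, Asym.refl _, Asym.refl _⟩

theorem dist_rot_rot (hX : IsBuildingWithoutA5 P B T 𝒜) {f : V ⊗[F] Λ → X} (hf : f ∈ 𝒜)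
    (u w : P.weylGroup) : Dist P B 𝒜 (rot f u) (rot f w) (u⁻¹ * w) :=
  ⟨rot f u, rot_mem hX hf u, Asym.refl _, by
    rw [rot_rot, mul_inv_cancel_left]; exact Asym.refl _⟩

variable [Nontrivial Λ]

theorem isPositive_of_sector_subset (hB : IsRootBasis P B) {J : Finset (ι × Λ)} {a : V ⊗[F] Λ}
    {w : P.weylGroup}
    (h : ∀ x ∈ fundChamber Λ P B, ∀ p ∈ J, p.2 ≤ coEval Λ P p.1 (a + w • x)) :
    ∀ p ∈ J, IsPositive P B (w⁻¹ • p.1) := fun p hp =>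
  isPositive_of_le_coEval_add_smul hB a w fun x hx => h x hx p hp

/-- The transition map is a translation on a whole sector, which forces its linear part to be
trivial. The intersection contains that sector, so all its bounding roots are positive. -/
theorem Asym.exists_transition (hB : IsRootBasis P B) (hX : IsBuildingWithoutA5 P B T 𝒜)
    {f g : V ⊗[F] Λ → X} (hf : f ∈ 𝒜) (hg : g ∈ 𝒜) (h : Asym P B f g) :
    ∃ (J : Finset (ι × Λ)) (t : V ⊗[F] Λ), t ∈ T ∧ (∀ p ∈ J, IsPositive P B p.1) ∧
      (∀ x, f x ∈ Set.range g ↔ ∀ p ∈ J, p.2 ≤ coEval Λ P p.1 x) ∧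
      ∀ x, f x ∈ Set.range g → f x = g (x + t) := by
  obtain ⟨a, b, h⟩ := h
  have h0 := h 0 zero_mem_fundChamber
  obtain ⟨J, u, t, ht, hJ, hu⟩ := GenAffineBuilding.exists_transition hX hf hg h0
  have h1 : u = 1 ∧ t = b - a := by
    refine weyl_affine_ext_sector (a := a) hB fun x hx => ?_
    have h2 := h x hx
    have h3 := hu (a + x) ⟨_, h2.symm⟩
    rw [h2] at h3
    rw [← hX.injective g hg h3, one_smul]
    abel
  obtain ⟨rfl, rfl⟩ := h1
  refine ⟨J, b - a, ht, fun p hp => ?_, hJ, fun x hx => by rw [hu x hx, one_smul]⟩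
  have h2 := isPositive_of_sector_subset (a := a) (w := 1) (J := J) hB (fun x hx => by
    rw [one_smul]; exact (hJ _).1 ⟨_, (h x hx).symm⟩) p hp
  rwa [inv_one, one_smul] at h2

/-- A chamber at infinity and a point determine a sector. -/
theorem Asym.sector_eq (hB : IsRootBasis P B) (hX : IsBuildingWithoutA5 P B T 𝒜)
    {f g : V ⊗[F] Λ → X} (hf : f ∈ 𝒜) (hg : g ∈ 𝒜) (h : Asym P B f g) {a b : V ⊗[F] Λ}
    (hab : f a = g b) {x : V ⊗[F] Λ} (hx : x ∈ fundChamber Λ P B) : f (a + x) = g (b + x) := by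
  obtain ⟨J, t, -, hpos, hJ, ht⟩ := h.exists_transition hB hX hf hg
  have h1 : f (a + x) ∈ Set.range g := by
    rw [hJ]
    intro p hp
    rw [map_add]
    exact le_add_of_le_of_nonneg ((hJ a).1 ⟨b, hab.symm⟩ p hp) (hx _ (hpos p hp))
  have h2 : b = a + t := hX.injective g hg (hab.symm.trans (ht a ⟨b, hab.symm⟩))
  rw [ht _ h1, h2, add_right_comm]

theorem eq_of_asym_rot (hB : IsRootBasis P B) (hX : IsBuildingWithoutA5 P B T 𝒜)
    {f g : V ⊗[F] Λ → X} (hg : g ∈ 𝒜) {t : V ⊗[F] Λ}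
    (ht : ∀ x, f x ∈ Set.range g → f x = g (x + t)) {u w : P.weylGroup}
    (h : Asym P B (rot f u) (rot g w)) : u = w := by
  obtain ⟨a, b, h⟩ := h
  refine (weyl_affine_ext_sector (a := a) (t := t) (t' := w • (b - a)) hB fun x hx => ?_).1
  have h1 := h x hx
  rw [rot_apply, rot_apply] at h1
  have h2 := ht _ ⟨_, h1.symm⟩
  rw [h1] at h2
  rw [← hX.injective g hg h2, ← smul_add]
  congr 1
  abel

theorem Dist.unique (hB : IsRootBasis P B) (hX : IsBuildingWithoutA5 P B T 𝒜)
    {f g : V ⊗[F] Λ → X} {u w : P.weylGroup} (h1 : Dist P B 𝒜 f g u) (h2 : Dist P B 𝒜 f g w) :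
    u = w := by
  obtain ⟨h, hh, ha, hb⟩ := h1
  obtain ⟨k, hk, hc, hd⟩ := h2
  obtain ⟨J, t, -, -, -, ht⟩ := (ha.symm.trans hB hc).exists_transition hB hX hh hk
  exact eq_of_asym_rot hB hX hk ht (hb.symm.trans hB hd)

/-- A sector of `X` contained in the fundamental sector of a chart `f` and in the apartment of a
chart `h`. -/
theorem exists_asym_rot (hB : IsRootBasis P B) (hX : IsBuildingWithoutA5 P B T 𝒜)
    {f h : V ⊗[F] Λ → X} (hf : f ∈ 𝒜) (hh : h ∈ 𝒜) {S : Set X} (hS : IsWeylChamberOf P B 𝒜 S)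
    (hSf : S ⊆ f '' fundChamber Λ P B) (hSh : S ⊆ Set.range h) :
    ∃ w : P.weylGroup, Asym P B f (rot h w) := by
  obtain ⟨g, hg, C, ⟨k, hk, rfl⟩, rfl⟩ := hS
  obtain ⟨v, p, -, rfl⟩ := mem_affineWeyl_iff.1 hk
  have hmem : ∀ x ∈ fundChamber Λ P B,
      g (v • x + p) ∈ g '' ((fun x => v • x + p) '' fundChamber Λ P B) :=
    fun x hx => ⟨_, ⟨x, hx, rfl⟩, rfl⟩
  obtain ⟨y0, -, hy0⟩ := hSf (hmem 0 zero_mem_fundChamber)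
  obtain ⟨J, u, t, -, hJ, hu⟩ := exists_transition hX hg hf hy0.symm
  have h1 : ∀ x ∈ fundChamber Λ P B, (u * v) • x + (u • p + t) ∈ fundChamber Λ P B ∧
      g (v • x + p) = f ((u * v) • x + (u • p + t)) := by
    intro x hx
    obtain ⟨y, hy, hyx⟩ := hSf (hmem x hx)
    have h2 := hu _ ⟨y, hyx⟩
    have h3 : u • (v • x + p) + t = (u * v) • x + (u • p + t) := by
      rw [smul_add, mul_smul, add_assoc]
    rw [h3] at h2
    refine ⟨?_, h2⟩
    rw [← hX.injective f hf (hyx.trans h2)]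
    exact hy
  -- A translated chamber contained in the fundamental chamber has the fundamental direction, since
  -- every simple root is bounded below on it.
  have h2 : u * v = 1 := by
    refine inv_eq_one.1 (eq_one_of_isPositive hB fun i hi => ?_)
    refine isPositive_of_le_coEval_add_smul (c := 0) hB (u • p + t) (u * v) fun x hx => ?_
    rw [add_comm]
    exact (h1 x hx).1 i (isPositive_of_mem hi)
  have h3 : ∀ x ∈ fundChamber Λ P B, f ((u • p + t) + x) ∈ Set.range h := by
    intro x hx
    have h4 := (h1 x hx).2
    rw [h2, one_smul, add_comm x] at h4
    rw [← h4]
    exact hSh (hmem x hx)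
  obtain ⟨z, hz⟩ := h3 0 zero_mem_fundChamber
  obtain ⟨J', u', t', -, -, hu'⟩ := exists_transition hX hf hh hz.symm
  refine ⟨u', u • p + t, u • p + t + u'⁻¹ • t', fun x hx => ?_⟩
  rw [hu' _ (h3 x hx), rot_apply]
  congr 1
  simp only [smul_add u', smul_inv_smul]
  abel

/-- Any two chambers at infinity lie in a common apartment. -/
theorem exists_dist (hB : IsRootBasis P B) (hX : IsBuildingWithoutA5 P B T 𝒜)
    {f g : V ⊗[F] Λ → X} (hf : f ∈ 𝒜) (hg : g ∈ 𝒜) : ∃ w, Dist P B 𝒜 f g w := by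
  have hC : IsWeylChamber P B (fundChamber Λ P B) :=
    ⟨id, mem_affineWeyl_iff.2 ⟨1, 0, AddSubgroup.mem_top _, by funext x; simp⟩,
      (Set.image_id _).symm⟩
  obtain ⟨S, S', hS, hSf, hS', hSg, h, hh, hr⟩ :=
    hX.A4 _ _ ⟨f, hf, _, hC, rfl⟩ ⟨g, hg, _, hC, rfl⟩
  obtain ⟨u, hu⟩ := exists_asym_rot hB hX hf hh hS hSf (Set.subset_union_left.trans hr)
  obtain ⟨w, hw⟩ := exists_asym_rot hB hX hg hh hS' hSg (Set.subset_union_right.trans hr)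
  exact ⟨u⁻¹ * w, (dist_rot_rot hX hh u w).congr hB hu.symm hw.symm⟩

end Infinity

/-! ### The building at infinity: adjacency, projections, exchange. -/

section Gate

variable {ι V N Λ X : Type*} {F : Subfield ℝ}
variable [AddCommGroup V] [Module F V] [AddCommGroup N] [Module F N]
variable [AddCommGroup Λ] [LinearOrder Λ] [IsOrderedAddMonoid Λ] [Module F Λ]
variable {P : RootPairing ι F V N} {B : Finset ι}
variable {T : AddSubgroup (V ⊗[F] Λ)} {𝒜 : Set (V ⊗[F] Λ → X)}
variable [Fintype ι] [P.IsRootSystem]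

theorem inducedDist_comm (hB : IsRootBasis P B) (hX : IsBuildingWithoutA5 P B T 𝒜) (x y : X) :
    inducedDist P B 𝒜 x y = inducedDist P B 𝒜 y x := by
  obtain ⟨f, hf, ⟨a, rfl⟩, ⟨b, rfl⟩⟩ := hX.A3 x y
  rw [inducedDist_eq hB hX hf, inducedDist_eq hB hX hf, modelDist_comm]

variable (P B 𝒜) in
/-- Two rays in `X` have bounded distance. -/
def RayBdd (r r' : Λ → X) : Prop := ∃ M, ∀ μ, 0 ≤ μ → inducedDist P B 𝒜 (r μ) (r' μ) ≤ M

theorem RayBdd.symm (hB : IsRootBasis P B) (hX : IsBuildingWithoutA5 P B T 𝒜) {r r' : Λ → X}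
    (h : RayBdd P B 𝒜 r r') : RayBdd P B 𝒜 r' r := by
  obtain ⟨M, h⟩ := h
  exact ⟨M, fun μ hμ => by rw [inducedDist_comm hB hX]; exact h μ hμ⟩

theorem RayBdd.trans (hTI : AxiomA5' P B 𝒜) {r r' r'' : Λ → X}
    (h : RayBdd P B 𝒜 r r') (h' : RayBdd P B 𝒜 r' r'') : RayBdd P B 𝒜 r r'' := by
  obtain ⟨M, h⟩ := h
  obtain ⟨M', h'⟩ := h'
  exact ⟨M + M', fun μ hμ => (hTI _ _ (r' μ)).trans (add_le_add (h μ hμ) (h' μ hμ))⟩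

variable [IsOrderedModule F Λ]

/-- Both rays are within a constant distance of a ray in the common subsector, namely the lengths of
the two translations to its base point. -/
theorem Asym.rayBdd (hB : IsRootBasis P B) (hX : IsBuildingWithoutA5 P B T 𝒜)
    (hTI : AxiomA5' P B 𝒜) {f g : V ⊗[F] Λ → X} (hf : f ∈ 𝒜) (hg : g ∈ 𝒜)
    (h : Asym P B f g) {v : V} (hv : IsDominant P B v) :
    RayBdd P B 𝒜 (fun μ => f (v ⊗ₜ μ)) (fun μ => g (v ⊗ₜ μ)) := by
  obtain ⟨a, b, h⟩ := h
  refine ⟨modelDist P B 0 a + modelDist P B 0 b, fun μ hμ => ?_⟩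
  have h1 := h _ (tmul_mem_fundChamber hv hμ)
  have h2 : ∀ c : V ⊗[F] Λ, modelDist P B (v ⊗ₜ μ) (c + v ⊗ₜ μ) = modelDist P B 0 c := by
    intro c
    simp only [modelDist, add_sub_cancel_right, sub_zero]
  refine (hTI _ _ (f (a + v ⊗ₜ μ))).trans (add_le_add ?_ ?_)
  · rw [inducedDist_eq hB hX hf, h2]
  · rw [h1, inducedDist_eq hB hX hg, modelDist_comm, h2]

variable [Nontrivial Λ]

theorem le_of_smul_le_smul_add {a b : F} {M : Λ} (h : ∀ μ : Λ, 0 ≤ μ → a • μ ≤ b • μ + M) :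
    a ≤ b := by
  by_contra hab
  obtain ⟨ε, hε⟩ := exists_zero_lt (α := Λ)
  obtain ⟨μ, hμ, h1⟩ := exists_le_smul (ι := Unit) (s := fun _ => a - b) (fun _ => M + ε)
  have h2 := h1 () (sub_pos.2 (not_le.1 hab))
  rw [sub_smul, le_sub_iff_add_le] at h2
  have h3 := h2.trans (h μ hμ)
  rw [add_comm (b • μ)] at h3
  have h4 := le_of_add_le_add_right h3
  exact absurd hε (not_lt.2 (by simpa using h4))

/-- Inside one apartment two rays from the origin diverge linearly with slope `rootNorm`. A bounded
perturbation at both ends does not change the slope. -/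
theorem rootNorm_le_of_rayBdd (hB : IsRootBasis P B) (hX : IsBuildingWithoutA5 P B T 𝒜)
    (hTI : AxiomA5' P B 𝒜) {f g : V ⊗[F] Λ → X} (hf : f ∈ 𝒜) (hg : g ∈ 𝒜) {v w v' w' : V}
    (h1 : RayBdd P B 𝒜 (fun μ => f (v ⊗ₜ μ)) (fun μ => g (v' ⊗ₜ μ)))
    (h2 : RayBdd P B 𝒜 (fun μ => f (w ⊗ₜ μ)) (fun μ => g (w' ⊗ₜ μ))) :
    rootNorm P B (v - w) ≤ rootNorm P B (v' - w') := by
  obtain ⟨M, h1⟩ := h1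
  obtain ⟨M', h2⟩ := h2
  have key : ∀ (f : V ⊗[F] Λ → X), f ∈ 𝒜 → ∀ (v w : V) (μ : Λ), 0 ≤ μ →
      inducedDist P B 𝒜 (f (w ⊗ₜ μ)) (f (v ⊗ₜ μ)) = rootNorm P B (v - w) • μ := by
    intro f hf v w μ hμ
    rw [inducedDist_eq hB hX hf, ← modelDist_add_tmul (w ⊗ₜ μ) (v - w) hμ,
      TensorProduct.sub_tmul, add_sub_cancel]
  refine le_of_smul_le_smul_add (M := M' + M) fun μ hμ => ?_
  rw [← key f hf v w μ hμ, ← key g hg v' w' μ hμ]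
  have h3 := hTI (f (w ⊗ₜ μ)) (f (v ⊗ₜ μ)) (g (v' ⊗ₜ μ))
  have h4 := hTI (f (w ⊗ₜ μ)) (g (v' ⊗ₜ μ)) (g (w' ⊗ₜ μ))
  have h5 := h1 μ hμ
  rw [inducedDist_comm hB hX] at h5
  refine h3.trans ((add_le_add (h4.trans (add_le_add_left (h2 μ hμ) _)) h5).trans ?_)
  apply le_of_eq
  abel

/-- Adjacent chambers at infinity have equal or adjacent distances from a given chamber. -/
theorem Dist.mul_reflW (hB : IsRootBasis P B) (hX : IsBuildingWithoutA5 P B T 𝒜)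
    (hTI : AxiomA5' P B 𝒜) {o e k : V ⊗[F] Λ → X} (ho : o ∈ 𝒜) (hk : k ∈ 𝒜)
    {i : ι} (hi : i ∈ B) {u : P.weylGroup} (h1 : Dist P B 𝒜 o e u)
    (h2 : Dist P B 𝒜 e k (reflW P i)) :
    Dist P B 𝒜 o k u ∨ Dist P B 𝒜 o k (u * reflW P i) := by
  obtain ⟨w, hw⟩ := exists_dist hB hX ho hk
  obtain ⟨η, hη, hη'⟩ := exists_panel (P := P) hB hi
  have hηd : IsDominant P B η := by
    intro j hj
    by_cases hr : IsRay P i j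
    · obtain ⟨c, hc⟩ := hr
      have h3 := coroot'_of_root_eq_smul hc
      rw [← h3, LinearMap.smul_apply, smul_eq_mul] at hη
      rcases mul_eq_zero.1 hη with h4 | h4
      · rw [h4, zero_smul] at hc; exact absurd hc (P.ne_zero j)
      · exact h4.ge
    · exact (hη' j hj hr).le
  have key : w = u ∨ w = u * reflW P i := by
    obtain ⟨f, hf, hof, hef⟩ := h1
    obtain ⟨q, hq, heq, hkq⟩ := h2
    obtain ⟨g, hg, hog, hkg⟩ := hw
    -- The panel ray `η` is fixed by the reflection in `i`, so the adjacent chambers `e` and `k`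
    -- share it; it appears in direction `u • η` in `f` and `w • η` in `g`.
    have h3 : RayBdd P B 𝒜 (fun μ => f ((u • η) ⊗ₜ μ)) (fun μ => g ((w • η) ⊗ₜ μ)) := by
      have h4 := (hef.symm.trans hB heq).rayBdd hB hX hTI (rot_mem hX hf u) hq hηd
      have h5 := (hkq.symm.trans hB hkg).rayBdd hB hX hTI (rot_mem hX hq _) (rot_mem hX hg w) hηd
      simp only [rot_apply, smul_tmul_weyl, reflW_smul_eq_self hη] at h4 h5
      exact h4.trans hTI h5
    refine eq_or_eq_mul_reflW hB hi hη hη' fun ζ hζ => ?_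
    have h6 := (hof.symm.trans hB hog).rayBdd hB hX hTI hf hg hζ
    exact le_antisymm (rootNorm_le_of_rayBdd hB hX hTI hf hg h3 h6)
      (rootNorm_le_of_rayBdd hB hX hTI hg hf (h3.symm hB hX) (h6.symm hB hX))
  rcases key with rfl | rfl
  · exact Or.inl hw
  · exact Or.inr hw

/-- Uniqueness of projections: in a panel, only one chamber is closest to a given chamber. -/
theorem Dist.gate (hB : IsRootBasis P B) (hX : IsBuildingWithoutA5 P B T 𝒜)
    (hTI : AxiomA5' P B 𝒜) {o e k : V ⊗[F] Λ → X} (ho : o ∈ 𝒜) (he : e ∈ 𝒜) (hk : k ∈ 𝒜)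
    {i : ι} (hi : i ∈ B) {u : P.weylGroup} (h1 : Dist P B 𝒜 o e u) (h2 : Dist P B 𝒜 o k u)
    (hui : IsPositive P B (u • i)) : ¬ Dist P B 𝒜 e k (reflW P i) := by
  intro h3
  generalize hn : len B u = n
  induction n using Nat.strong_induction_on generalizing o u with
  | _ n ih =>
    by_cases hu : u = 1
    · subst hu
      have h4 := ((h1.asym hB).symm.trans hB (h2.asym hB)).dist he
      exact reflW_ne_one i (h3.unique hB hX h4)
    -- The chamber `o` is moved one step along a minimal gallery towards `e`, which shortens `u` to
    -- `reflW P l * u`.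
    obtain ⟨l, hl, hul⟩ := exists_not_isPositive hB (inv_ne_one.2 hu)
    have hpos : IsPositive P B (reflW P l • u • i) := by
      by_contra hneg
      have hr := isRay_of_reflW hB hl hui hneg
      have h4 := hr.isPositive_smul hB (isPositive_of_mem hl) hui u⁻¹
      rw [inv_smul_smul] at h4
      exact hul (h4.1 (isPositive_of_mem hi))
    obtain ⟨h, hh, hoh, heh⟩ := id h1
    have ho1 := rot_mem hX hh (reflW P l)
    have h4 : Dist P B 𝒜 (rot h (reflW P l)) e (reflW P l * u) := by
      have h5 := dist_rot_rot hX hh (reflW P l) u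
      rw [reflW_inv] at h5
      exact h5.congr hB (Asym.refl _) heh.symm
    have h5 : Dist P B 𝒜 o (rot h (reflW P l)) (reflW P l) := ⟨h, hh, hoh, Asym.refl _⟩
    have h6 : Dist P B 𝒜 (rot h (reflW P l)) k u ∨
        Dist P B 𝒜 (rot h (reflW P l)) k (reflW P l * u) := by
      rcases (h2.symm hX).mul_reflW hB hX hTI hk ho1 hl h5 with h6 | h6
      · left; simpa using h6.symm hX
      · right
        have h7 := h6.symm hX
        rwa [mul_inv_rev, inv_inv, reflW_inv] at h7
    -- Adjacency to `o` and adjacency to `e` each leave two values for the distance to `k`. Any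
    -- common value other than the desired one would give u = s_l u s_i, contradicting the signs of
    -- u·i and s_l u·i.
    have h7 : Dist P B 𝒜 (rot h (reflW P l)) k (reflW P l * u) := by
      rcases h4.mul_reflW hB hX hTI ho1 hk hi h3 with h7 | h7
      · exact h7
      rcases h6 with h8 | h8
      · exfalso
        have h9 := h7.unique hB hX h8
        have h10 : reflW P l • u • reflW P i • i = u • i := by
          conv_rhs => rw [← h9]
          rw [mul_smul, mul_smul]
        rw [smul_reflW_self, smul_reflW_self] at h10
        rw [← h10, isPositive_reflW_self hB] at hui
        exact hui hpos
      · exact h8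
    refine ih _ ?_ ho1 h4 h7 (by rwa [mul_smul]) rfl
    rw [← hn, len_reflW_mul' hB hl hul]
    exact Nat.lt_add_of_pos_right (rayMult_pos hl)

/-- Every bounding root of the intersection is positive for both common chambers at infinity. Only
the positive multiples of `i` satisfy this, so the constraints reduce to a single one. -/
theorem half_or_all (hB : IsRootBasis P B) (hX : IsBuildingWithoutA5 P B T 𝒜)
    {h g : V ⊗[F] Λ → X} (hh : h ∈ 𝒜) (hg : g ∈ 𝒜) {i : ι} (hi : i ∈ B) {w : P.weylGroup}
    (hw : IsLongest B w) (h1 : Asym P B h g)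
    (h2 : Asym P B (rot h (reflW P i * w)) (rot g (reflW P i * w))) :
    ∃ t ∈ T, ((∀ x, h x ∈ Set.range g) ∨ ∃ κ, ∀ x, h x ∈ Set.range g ↔ κ ≤ coEval Λ P i x) ∧
      ∀ x, h x ∈ Set.range g → h x = g (x + t) := by
  obtain ⟨J, t, ht, hpos, hJ, hgt⟩ := h1.exists_transition hB hX hh hg
  refine ⟨t, ht, ?_, hgt⟩
  obtain ⟨a, b, hab⟩ := h2
  have h3 := isPositive_of_sector_subset (a := (reflW P i * w) • a) (w := reflW P i * w) (J := J)
    hB (fun x hx => by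
      rw [← smul_add]
      refine (hJ _).1 ⟨_, (hab x hx).symm⟩)
  have h4 : ∀ p ∈ J, ∃ κ, ∀ x, p.2 ≤ coEval Λ P p.1 x ↔ κ ≤ coEval Λ P i x := by
    intro p hp
    have h5 := h3 p hp
    rw [mul_inv_rev, mul_smul, reflW_inv] at h5
    have h6 : ¬ IsPositive P B (reflW P i • p.1) := fun h6 => hw.not_isPositive_inv hB h6 h5
    obtain ⟨c, hc⟩ := isRay_of_reflW hB hi (hpos p hp) h6
    have hc0 := (isPositive_of_isRay hB hc (isPositive_of_mem hi)).1 (hpos p hp)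
    refine ⟨c • p.2, fun x => ?_⟩
    rw [← coEval_of_coroot'_smul (coroot'_of_root_eq_smul hc)]
    constructor
    · exact fun h => smul_le_smul_of_nonneg_left h hc0.le
    · intro h
      have h7 := smul_le_smul_of_nonneg_left h (inv_nonneg.2 hc0.le)
      rwa [inv_smul_smul₀ hc0.ne', inv_smul_smul₀ hc0.ne'] at h7
  choose! κ hκ using h4
  rcases J.eq_empty_or_nonempty with rfl | hne
  · left
    intro x
    rw [hJ]
    simp
  · right
    obtain ⟨p, hp, hmax⟩ := J.exists_max_image κ hne
    refine ⟨κ p, fun x => ?_⟩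
    rw [hJ]
    exact ⟨fun h => (hκ p hp x).1 (h p hp),
      fun h q hq => (hκ q hq x).2 ((hmax q hq).trans h)⟩

/-- If the chamber `k` at infinity is adjacent to a chamber of the apartment of `h` but not
contained in it, then `k` and a half-apartment of `h` are contained in a common apartment. -/
theorem exists_half (hB : IsRootBasis P B) (hX : IsBuildingWithoutA5 P B T 𝒜)
    (hTI : AxiomA5' P B 𝒜) {h k : V ⊗[F] Λ → X} (hh : h ∈ 𝒜) (hk : k ∈ 𝒜) {i : ι} (hi : i ∈ B)
    {w : P.weylGroup} (hw : IsLongest B w) (hd : Dist P B 𝒜 h k (reflW P i))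
    (hn : ¬ Asym P B k (rot h (reflW P i))) :
    ∃ g ∈ 𝒜, ∃ κ, (∀ x, h x ∈ Set.range g ↔ κ ≤ coEval Λ P i x) ∧
      (∀ x, h x ∈ Set.range g → h x = g x) ∧ Asym P B k (rot g (reflW P i)) ∧
      Asym P B (rot h (reflW P i * w)) (rot g (reflW P i * w)) := by
  have ho := rot_mem hX hh (reflW P i * w)
  have h1 : Dist P B 𝒜 (rot h (reflW P i * w)) h (reflW P i * w)⁻¹ := (dist_rot hh _).symm hX
  have hpos : IsPositive P B ((reflW P i * w)⁻¹ • i) := by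
    rw [mul_inv_rev, reflW_inv, mul_smul, smul_reflW_self, isPositive_reflW_self hB]
    exact hw.not_isPositive_inv hB (isPositive_of_mem hi)
  -- In the `i`-panel, `h` is the projection of the chamber `rot h (reflW P i * w)`. By uniqueness
  -- `k` is not, so `k` is opposite to that chamber.
  have h2 : Dist P B 𝒜 (rot h (reflW P i * w)) k w⁻¹ := by
    rcases h1.mul_reflW hB hX hTI ho hk hi hd with h2 | h2
    · exact absurd hd (h1.gate hB hX hTI ho hh hk hi h2 hpos)
    · rwa [mul_inv_rev, reflW_inv, mul_assoc, reflW_mul_self, mul_one] at h2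
  have h3 := h2.symm hX
  rw [inv_inv] at h3
  obtain ⟨q, hq, hkq, hoq⟩ := h3
  have hg1 := rot_mem hX hq (reflW P i)
  have h4 : Dist P B 𝒜 (rot h (reflW P i * w)) (rot q (reflW P i)) (reflW P i * w)⁻¹ := by
    rw [mul_inv_rev, reflW_inv]
    exact (dist_rot_rot hX hq w (reflW P i)).congr hB hoq.symm (Asym.refl _)
  have h5 : Dist P B 𝒜 k (rot q (reflW P i)) (reflW P i) := ⟨q, hq, hkq, Asym.refl _⟩
  -- The neighbour of `k` in the new apartment is also the projection to this panel, hence equals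
  -- `h` at infinity.
  have h6 : Asym P B h (rot q (reflW P i)) := by
    rcases hd.mul_reflW hB hX hTI hh hg1 hi h5 with h6 | h6
    · exact absurd h6 (h1.gate hB hX hTI ho hh hg1 hi h4 hpos)
    · rw [reflW_mul_self] at h6
      exact h6.asym hB
  have h7 : Asym P B (rot h (reflW P i * w)) (rot (rot q (reflW P i)) (reflW P i * w)) := by
    rw [rot_rot, ← mul_assoc, reflW_mul_self, one_mul]
    exact hoq
  obtain ⟨t, ht, h8, h9⟩ := half_or_all hB hX hh hg1 hi hw h6 h7
  have h10 : Asym P B k (rot (shift (rot q (reflW P i)) t) (reflW P i)) := by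
    have h11 := asym_shift (P := P) (B := B) (rot q (reflW P i)) t (reflW P i)
    rw [rot_rot q, reflW_mul_self, rot_one] at h11
    exact hkq.trans hB h11.symm
  -- Translating the chart makes it equal to `h` on the intersection. If that were everything, `k`
  -- would lie in the apartment of `h`.
  rcases h8 with h8 | ⟨κ, h8⟩
  · exfalso
    have h11 : h = shift (rot q (reflW P i)) t := funext fun x => h9 x (h8 x)
    rw [← h11] at h10
    exact hn h10
  · refine ⟨shift (rot q (reflW P i)) t, shift_mem hX hg1 ht, κ, ?_, ?_, h10, ?_⟩
    · rw [range_shift]; exact h8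
    · rw [range_shift]; exact h9
    · exact h7.trans hB (asym_shift _ _ _).symm

theorem isHalfApartmentOf_inter {f g : V ⊗[F] Λ → X} (hf : f ∈ 𝒜) {i : ι} {κ : Λ}
    (h : ∀ x, f x ∈ Set.range g ↔ κ ≤ coEval Λ P i x) :
    IsHalfApartmentOf P 𝒜 (Set.range f ∩ Set.range g) := by
  refine ⟨f, hf, _, ⟨i, κ, rfl⟩, ?_⟩
  ext y
  constructor
  · rintro ⟨⟨x, rfl⟩, hx⟩
    exact ⟨x, (h x).1 hx, rfl⟩
  · rintro ⟨x, hx, rfl⟩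
    exact ⟨⟨x, rfl⟩, (h x).2 hx⟩

theorem exists_coEval_eq (i : ι) (c : Λ) : ∃ x : V ⊗[F] Λ, coEval Λ P i x = c := by
  refine ⟨P.root i ⊗ₜ ((2 : F)⁻¹ • c), ?_⟩
  rw [coEval_tmul, RootPairing.root_coroot'_eq_pairing, RootPairing.pairing_same,
    smul_inv_smul₀ two_ne_zero]

/-- `exists_half` is applied to `h` and to its reflected chart, producing two opposite
half-apartments. The content is that they overlap, for which (A6) is needed. -/
theorem exists_exchange_one (hB : IsRootBasis P B) (hX : IsBuildingWithoutA5 P B T 𝒜)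
    (hTI : AxiomA5' P B 𝒜) {h k : V ⊗[F] Λ → X} (hh : h ∈ 𝒜) (hk : k ∈ 𝒜) {i : ι} (hi : i ∈ B)
    (hd : Dist P B 𝒜 h k (reflW P i)) (hn : ¬ Asym P B k (rot h (reflW P i))) :
    ∃ g₁ ∈ 𝒜, ∃ g₂ ∈ 𝒜, ∃ κ₁ κ₂, κ₁ ≤ κ₂ ∧
      (∀ x, κ₁ ≤ coEval Λ P i x → g₁ x = h x) ∧ Asym P B k (rot g₁ (reflW P i)) ∧
      (∀ x, coEval Λ P i x ≤ κ₂ → g₂ x = h x) ∧ Asym P B k g₂ := by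
  obtain ⟨w, hw⟩ := exists_isLongest P hB
  obtain ⟨g, hg, κ, hr, he, hkg, hgo⟩ := exists_half hB hX hTI hh hk hi hw hd hn
  have hh' := rot_mem hX hh (reflW P i)
  have hd' : Dist P B 𝒜 (rot h (reflW P i)) k (reflW P i) := by
    have h1 := (dist_rot (B := B) hh (reflW P i)).symm hX
    rw [reflW_inv] at h1
    rcases h1.mul_reflW hB hX hTI hh' hk hi hd with h2 | h2
    · exact h2
    · rw [reflW_mul_self] at h2
      exact absurd (h2.asym hB).symm hn
  have hn' : ¬ Asym P B k (rot (rot h (reflW P i)) (reflW P i)) := by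
    rw [rot_rot, reflW_mul_self, rot_one]
    intro h1
    exact reflW_ne_one i (hd.unique hB hX (h1.symm.dist hh))
  obtain ⟨g', hg', κ', hr', he', hkg', hgo'⟩ := exists_half hB hX hTI hh' hk hi hw hd' hn'
  have hc : ∀ x : V ⊗[F] Λ, coEval Λ P i (reflW P i • x) = -coEval Λ P i x := fun x => by
    rw [coEval_smul', reflW_inv, coEval_reflW_self]
  have hr2 : ∀ x, h x ∈ Set.range (rot g' (reflW P i)) ↔ coEval Λ P i x ≤ -κ' := by
    intro x
    have h1 := hr' (reflW P i • x)
    rw [rot_apply, reflW_reflW_smul, hc] at h1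
    rw [range_rot, h1]
    exact le_neg
  have hg2 := rot_mem hX hg' (reflW P i)
  have hG1 := rot_mem hX hg (reflW P i)
  have hGG : Asym P B (rot g (reflW P i)) (rot g' (reflW P i)) := hkg.symm.trans hB hkg'
  obtain ⟨l, hl, hwl⟩ := hw.exists_conj hB hi
  -- The two chambers lie in one `l`-panel together with two chambers of `h`. Both have the distance
  -- to `k` of the projection to that panel, so `Dist.gate` identifies them.
  have hopp : Asym P B (rot (rot g (reflW P i)) (reflW P i * w))
      (rot (rot g' (reflW P i)) (reflW P i * w)) := by
    have e : ∀ f : V ⊗[F] Λ → X, rot (rot f (reflW P i)) (reflW P i * w) = rot f w := fun f => by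
      rw [rot_rot, ← mul_assoc, reflW_mul_self, one_mul]
    rw [e, e]
    rw [rot_rot, ← mul_assoc, reflW_mul_self, one_mul] at hgo'
    have h1 : Dist P B 𝒜 (rot g w) (rot h (reflW P i * w)) (reflW P l) := by
      have h1 := (dist_rot_rot hX hg w (reflW P i * w)).congr hB (Asym.refl _) hgo.symm
      rwa [← hwl, inv_mul_cancel_left, hwl] at h1
    have h2 : Dist P B 𝒜 (rot h (reflW P i * w)) (rot h w) (reflW P l) := by
      have h2 := dist_rot_rot (B := B) hX hh (reflW P i * w) w
      rw [← hwl] at h2 ⊢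
      rwa [mul_inv_rev, reflW_inv, mul_assoc, inv_mul_cancel, mul_one] at h2
    have h3 : Dist P B 𝒜 (rot h w) (rot g' w) (reflW P l) := by
      have h3 := dist_rot_rot (B := B) hX hg' (reflW P i * w) w
      rw [← hwl, mul_inv_rev, reflW_inv, mul_assoc, inv_mul_cancel, mul_one, hwl] at h3
      exact h3.congr hB hgo'.symm (Asym.refl _)
    have hgw := rot_mem hX hg w
    have hg'w := rot_mem hX hg' w
    have h4 : Dist P B 𝒜 (rot g w) (rot g' w) 1 ∨
        Dist P B 𝒜 (rot g w) (rot g' w) (reflW P l) := by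
      rcases h1.mul_reflW hB hX hTI hgw (rot_mem hX hh w) hl h2 with h4 | h4
      · rcases h4.mul_reflW hB hX hTI hgw hg'w hl h3 with h5 | h5
        · exact Or.inr h5
        · rw [reflW_mul_self] at h5
          exact Or.inl h5
      · rw [reflW_mul_self] at h4
        exact Or.inr (h3.congr hB (h4.asym hB).symm (Asym.refl _))
    rcases h4 with h4 | h4
    · exact h4.asym hB
    · exfalso
      have h5 : ∀ f : V ⊗[F] Λ → X, f ∈ 𝒜 → Asym P B k (rot f (reflW P i)) →
          Dist P B 𝒜 k (rot f w) (reflW P i * w) := by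
        intro f hf hkf
        have h6 := dist_rot_rot (B := B) hX hf (reflW P i) w
        rw [reflW_inv] at h6
        exact h6.congr hB hkf.symm (Asym.refl _)
      refine (h5 g hg hkg).gate hB hX hTI hk hgw hg'w hl (h5 g' hg' hkg') ?_ h4
      rw [← hwl, mul_smul, smul_reflW_self, isPositive_reflW_self hB]
      exact hw l hl
  -- The two new apartments meet in a half-apartment or coincide. In the first case (A6) gives a
  -- point of `h` in both halves; in the second, a point on the wall at `κ` lies in both.
  have hκ : κ ≤ -κ' := by
    obtain ⟨t, -, h1, h2⟩ := half_or_all hB hX hG1 hg2 hi hw hGG hopp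
    rcases h1 with h1 | ⟨κ₃, h1⟩
    · obtain ⟨x, hx⟩ := exists_coEval_eq (P := P) i κ
      rw [← hx, ← hr2]
      obtain ⟨y, hy⟩ := (hr x).2 hx.ge
      rw [← hy]
      have h3 := h1 (reflW P i • y)
      rwa [rot_apply, reflW_reflW_smul] at h3
    · obtain ⟨-, ⟨⟨x, rfl⟩, hx⟩, hx'⟩ := hX.A6 h hh _ hG1 _ hg2
        (isHalfApartmentOf_inter (g := rot g (reflW P i)) hh (by rw [range_rot]; exact hr))
        (isHalfApartmentOf_inter hG1 h1) (by
          refine isHalfApartmentOf_inter (i := reflW P i • i) (κ := κ') hh fun x => ?_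
          rw [hr2, coEval_reflW_self]
          exact le_neg)
      rw [range_rot] at hx
      exact ((hr x).1 hx).trans ((hr2 x).1 hx')
  refine ⟨g, hg, rot g' (reflW P i), hg2, κ, -κ', hκ, fun x hx => (he x ((hr x).2 hx)).symm, hkg,
    fun x hx => ?_, hkg'⟩
  have h1 := (hr2 x).2 hx
  rw [range_rot] at h1
  have h2 := he' (reflW P i • x) (by rw [rot_apply, reflW_reflW_smul]; exact h1)
  rw [rot_apply, reflW_reflW_smul] at h2
  exact h2.symm

/-- The exchange condition: if the chamber `k` at infinity is adjacent to a chamber of the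
apartment of `h` but not contained in it, then this apartment is covered by two half-apartments,
each of which is contained in an apartment containing `k`. -/
theorem exists_exchange (hB : IsRootBasis P B) (hX : IsBuildingWithoutA5 P B T 𝒜)
    (hTI : AxiomA5' P B 𝒜) {h k : V ⊗[F] Λ → X} (hh : h ∈ 𝒜) (hk : k ∈ 𝒜) {i : ι} (hi : i ∈ B)
    {v : P.weylGroup} (hd : Dist P B 𝒜 (rot h v) k (reflW P i))
    (hn : ¬ Asym P B k (rot h (v * reflW P i))) :
    ∃ g₁ ∈ 𝒜, ∃ g₂ ∈ 𝒜, ∃ κ₁ κ₂, κ₁ ≤ κ₂ ∧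
      (∀ x, κ₁ ≤ coEval Λ P (v • i) x → g₁ x = h x) ∧ Asym P B k (rot g₁ (v * reflW P i)) ∧
      (∀ x, coEval Λ P (v • i) x ≤ κ₂ → g₂ x = h x) ∧ Asym P B k (rot g₂ v) := by
  rw [← rot_rot] at hn
  obtain ⟨g₁, hg₁, g₂, hg₂, κ₁, κ₂, hκ, h1, h2, h3, h4⟩ :=
    exists_exchange_one hB hX hTI (rot_mem hX hh v) hk hi hd hn
  have hc : ∀ x : V ⊗[F] Λ, coEval Λ P i (v⁻¹ • x) = coEval Λ P (v • i) x := fun x => by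
    rw [coEval_smul', inv_inv]
  refine ⟨rot g₁ v⁻¹, rot_mem hX hg₁ _, rot g₂ v⁻¹, rot_mem hX hg₂ _, κ₁, κ₂, hκ, fun x hx => ?_,
    ?_, fun x hx => ?_, ?_⟩
  · rw [rot_apply, h1 _ (by rwa [hc]), rot_apply, smul_inv_smul]
  · rw [rot_rot, inv_mul_cancel_left]; exact h2
  · rw [rot_apply, h3 _ (by rwa [hc]), rot_apply, smul_inv_smul]
  · rw [rot_rot, inv_mul_cancel, rot_one]; exact h4

end Gate

/-! ### Sector germs, opposite sectors and covers of apartments. -/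

section Germs

variable {ι V N Λ X : Type*} {F : Subfield ℝ}
variable [AddCommGroup V] [Module F V] [AddCommGroup N] [Module F N]
variable [AddCommGroup Λ] [LinearOrder Λ] [IsOrderedAddMonoid Λ] [Module F Λ]
variable {P : RootPairing ι F V N} {B : Finset ι}
variable {T : AddSubgroup (V ⊗[F] Λ)} {𝒜 : Set (V ⊗[F] Λ → X)}

variable (P B) in
/-- The charts `m` and `n` agree on the germ at `b` of the sector of fundamental direction. -/
def GermEq (m n : V ⊗[F] Λ → X) (b : V ⊗[F] Λ) : Prop :=
  ∃ ε : Λ, 0 < ε ∧ ∀ x ∈ fundChamber Λ P B, (∀ i, coEval Λ P i x < ε) → n (b + x) = m (b + x)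

theorem GermEq.apply {m n : V ⊗[F] Λ → X} {b : V ⊗[F] Λ} (h : GermEq P B m n b) : n b = m b := by
  obtain ⟨ε, hε, h⟩ := h
  have := h 0 zero_mem_fundChamber (fun i => by rw [map_zero]; exact hε)
  rwa [add_zero] at this

theorem GermEq.refl [Nontrivial Λ] (m : V ⊗[F] Λ → X) (b : V ⊗[F] Λ) : GermEq P B m m b := by
  obtain ⟨ε, hε⟩ := exists_zero_lt (α := Λ)
  exact ⟨ε, hε, fun _ _ _ => rfl⟩

theorem GermEq.of_ge {m n g : V ⊗[F] Λ → X} {b : V ⊗[F] Λ} (h : GermEq P B m n b) {j : ι}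
    {κ : Λ} (hj : IsPositive P B j) (hb : κ ≤ coEval Λ P j b)
    (hg : ∀ x, κ ≤ coEval Λ P j x → g x = n x) : GermEq P B m g b := by
  obtain ⟨ε, hε, h⟩ := h
  refine ⟨ε, hε, fun x hx hs => ?_⟩
  rw [hg, h x hx hs]
  rw [map_add]
  exact le_add_of_le_of_nonneg hb (hx j hj)

theorem GermEq.of_lt {m n g : V ⊗[F] Λ → X} {b : V ⊗[F] Λ} (h : GermEq P B m n b) {j : ι}
    {κ : Λ} (hb : coEval Λ P j b < κ) (hg : ∀ x, coEval Λ P j x ≤ κ → g x = n x) :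
    GermEq P B m g b := by
  obtain ⟨ε, hε, h⟩ := h
  refine ⟨min ε (κ - coEval Λ P j b), lt_min hε (sub_pos.2 hb), fun x hx hs => ?_⟩
  rw [hg, h x hx fun i => (hs i).trans_le (min_le_left _ _)]
  rw [map_add]
  exact (lt_sub_iff_add_lt'.1 ((hs j).trans_le (min_le_right _ _))).le

variable [Fintype ι]

/-- The halves overlap or share their wall, so either `b` is strictly inside one of them or it lies
in the one towards which the sector points. -/
theorem GermEq.exchange (hB : IsRootBasis P B) {m n g₁ g₂ : V ⊗[F] Λ → X} {b : V ⊗[F] Λ}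
    (h : GermEq P B m n b) {j : ι} {κ₁ κ₂ : Λ} (hκ : κ₁ ≤ κ₂)
    (h₁ : ∀ x, κ₁ ≤ coEval Λ P j x → g₁ x = n x) (h₂ : ∀ x, coEval Λ P j x ≤ κ₂ → g₂ x = n x) :
    GermEq P B m g₁ b ∨ GermEq P B m g₂ b := by
  by_cases hj : IsPositive P B j
  · rcases le_or_gt κ₁ (coEval Λ P j b) with hb | hb
    · exact Or.inl (h.of_ge hj hb h₁)
    · exact Or.inr (h.of_lt (hb.trans_le hκ) h₂)
  · rcases le_or_gt (coEval Λ P j b) κ₂ with hb | hb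
    · refine Or.inr (h.of_ge (κ := -κ₂) ((isPositive_reflW_self hB j).2 hj) ?_ fun x hx => h₂ x ?_)
      · rw [coEval_reflW_self]; exact neg_le_neg hb
      · rw [coEval_reflW_self] at hx; exact neg_le_neg_iff.1 hx
    · refine Or.inl (h.of_lt (j := reflW P j • j) (κ := -κ₁) ?_ fun x hx => h₁ x ?_)
      · rw [coEval_reflW_self]; exact neg_lt_neg (hκ.trans_lt hb)
      · rw [coEval_reflW_self] at hx; exact neg_le_neg_iff.1 hx

variable [P.IsRootSystem] [IsOrderedModule F Λ]

/-- Charts that agree on a germ agree wherever their apartments meet. -/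
theorem GermEq.eq_of_mem (hB : IsRootBasis P B) (hX : IsBuildingWithoutA5 P B T 𝒜)
    {m n n' : V ⊗[F] Λ → X} (hn : n ∈ 𝒜) (hn' : n' ∈ 𝒜) {b : V ⊗[F] Λ} (h : GermEq P B m n b)
    (h' : GermEq P B m n' b) {x : V ⊗[F] Λ} (hx : n x ∈ Set.range n') : n x = n' x := by
  obtain ⟨J, u, t, -, -, hu⟩ := exists_transition hX hn hn' (h.apply.trans h'.apply.symm)
  obtain ⟨ε, hε, h⟩ := h
  obtain ⟨ε', hε', h'⟩ := h'
  have h1 : u = 1 ∧ t = 0 := by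
    refine weyl_affine_ext (a := b) hB (lt_min hε hε') fun y hy hs => ?_
    have h2 := h y hy fun i => (hs i).trans_le (min_le_left _ _)
    have h3 := h' y hy fun i => (hs i).trans_le (min_le_right _ _)
    rw [← h3] at h2
    rw [one_smul, add_zero]
    exact hX.injective n' hn' ((hu _ ⟨_, h2.symm⟩).symm.trans h2)
  rw [hu x hx, h1.1, h1.2, one_smul, add_zero]

variable [Nontrivial Λ]

/-- The direction of a chamber at infinity relative to a germ is well-defined. -/
theorem GermEq.unique (hB : IsRootBasis P B) (hX : IsBuildingWithoutA5 P B T 𝒜)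
    {m n n' c : V ⊗[F] Λ → X} (hn : n ∈ 𝒜) (hn' : n' ∈ 𝒜) {b : V ⊗[F] Λ} (h : GermEq P B m n b)
    (h' : GermEq P B m n' b) {v v' : P.weylGroup} (hv : Asym P B c (rot n v))
    (hv' : Asym P B c (rot n' v')) : v = v' :=
  eq_of_asym_rot hB hX hn' (t := 0)
    (fun x hx => by rw [add_zero]; exact h.eq_of_mem hB hX hn hn' h' hx) (hv.symm.trans hB hv')

/-- One step in changing the chamber at infinity of an apartment containing a given germ. -/
theorem GermEq.exists_step (hB : IsRootBasis P B) (hX : IsBuildingWithoutA5 P B T 𝒜)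
    (hTI : AxiomA5' P B 𝒜) {m n k : V ⊗[F] Λ → X} (hn : n ∈ 𝒜) (hk : k ∈ 𝒜) {b : V ⊗[F] Λ}
    (h : GermEq P B m n b) {v : P.weylGroup} {i : ι} (hi : i ∈ B)
    (hd : Dist P B 𝒜 (rot n v) k (reflW P i)) :
    ∃ n' ∈ 𝒜, ∃ v', (v' = v ∨ v' = v * reflW P i) ∧ GermEq P B m n' b ∧
      Asym P B k (rot n' v') := by
  by_cases hk' : Asym P B k (rot n (v * reflW P i))
  · exact ⟨n, hn, _, Or.inr rfl, h, hk'⟩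
  · obtain ⟨g₁, hg₁, g₂, hg₂, κ₁, κ₂, hκ, h1, h2, h3, h4⟩ :=
      exists_exchange hB hX hTI hn hk hi hd hk'
    rcases h.exchange hB hκ h1 h3 with h5 | h5
    · exact ⟨g₁, hg₁, _, Or.inr rfl, h5, h2⟩
    · exact ⟨g₂, hg₂, _, Or.inl rfl, h5, h4⟩

/-- A germ and a chamber at infinity lie in a common apartment. -/
theorem exists_germEq_asym (hB : IsRootBasis P B) (hX : IsBuildingWithoutA5 P B T 𝒜)
    (hTI : AxiomA5' P B 𝒜) {m c : V ⊗[F] Λ → X} (hm : m ∈ 𝒜) (hc : c ∈ 𝒜) (b : V ⊗[F] Λ) :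
    ∃ n ∈ 𝒜, ∃ v : P.weylGroup, GermEq P B m n b ∧ Asym P B c (rot n v) := by
  suffices H : ∀ (l : ℕ) (n : V ⊗[F] Λ → X) (v y : P.weylGroup), n ∈ 𝒜 → GermEq P B m n b →
      Dist P B 𝒜 (rot n v) c y → len B y = l →
      ∃ n ∈ 𝒜, ∃ v : P.weylGroup, GermEq P B m n b ∧ Asym P B c (rot n v) by
    obtain ⟨y, hy⟩ := exists_dist hB hX hm hc
    exact H _ m 1 y hm (GermEq.refl m b) (by rwa [rot_one]) rfl
  intro l
  induction l using Nat.strong_induction_on with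
  | _ l ih =>
    intro n v y hn hg hd hl
    by_cases hy : y = 1
    · subst hy
      exact ⟨n, hn, v, hg, (hd.asym hB).symm⟩
    -- Advance one step along a minimal gallery towards `c`, replacing the chart so that it keeps
    -- the germ and contains the next chamber; the remaining distance gets shorter.
    · obtain ⟨i, hi, hiy⟩ := exists_not_isPositive hB (inv_ne_one.2 hy)
      obtain ⟨q, hq, hnq, hcq⟩ := hd
      have hk := rot_mem hX hq (reflW P i)
      have hd1 : Dist P B 𝒜 (rot n v) (rot q (reflW P i)) (reflW P i) :=
        ⟨q, hq, hnq, Asym.refl _⟩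
      have hd2 : Dist P B 𝒜 (rot q (reflW P i)) c (reflW P i * y) := by
        have h1 := dist_rot_rot (B := B) hX hq (reflW P i) y
        rw [reflW_inv] at h1
        exact h1.congr hB (Asym.refl _) hcq.symm
      obtain ⟨n', hn', v', -, hg', hk'⟩ := hg.exists_step hB hX hTI hn hk hi hd1
      refine ih _ ?_ n' v' _ hn' hg' (hd2.congr hB hk' (Asym.refl _)) rfl
      rw [← hl, len_reflW_mul' hB hi hiy]
      exact Nat.lt_add_of_pos_right (rayMult_pos hi)

theorem le_len_mul_reflW_add (hB : IsRootBasis P B) (v : P.weylGroup) {i : ι} (hi : i ∈ B) :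
    len B v ≤ len B (v * reflW P i) + rayMult P B i := by
  by_cases h : IsPositive P B (v • i)
  · rw [len_mul_reflW hB hi h]; omega
  · exact (len_mul_reflW' hB hi h).le

/-- The Weyl distance of germs is dominated by the Weyl distance of chambers at infinity, and in
case of equality the sector of `m` at `b` and the chamber at infinity lie in a common apartment. -/
theorem len_le_and_exists_sector (hB : IsRootBasis P B) (hX : IsBuildingWithoutA5 P B T 𝒜)
    (hTI : AxiomA5' P B 𝒜) {m : V ⊗[F] Λ → X} (hm : m ∈ 𝒜) (b : V ⊗[F] Λ) {y : P.weylGroup}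
    {c n : V ⊗[F] Λ → X} {v : P.weylGroup} (hn : n ∈ 𝒜) (hd : Dist P B 𝒜 m c y) (hc : c ∈ 𝒜)
    (hg : GermEq P B m n b) (hcn : Asym P B c (rot n v)) :
    len B v ≤ len B y ∧ (len B v = len B y → ∃ g ∈ 𝒜,
      (∀ x ∈ fundChamber Λ P B, g (b + x) = m (b + x)) ∧ Asym P B c (rot g v)) := by
  generalize hl : len B y = l
  induction l using Nat.strong_induction_on generalizing c n v y with
  | _ l ih =>
    by_cases hy : y = 1
    · subst hy
      have h1 := (hd.asym hB).symm
      have hv : v = 1 := hg.unique hB hX hn hm (GermEq.refl m b) hcn (by rwa [rot_one])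
      subst hv
      refine ⟨?_, fun _ => ⟨m, hm, fun _ _ => rfl, by rwa [rot_one]⟩⟩
      rw [len_one]; exact Nat.zero_le _
    obtain ⟨i, hi, hiy⟩ := exists_not_isPositive hB hy
    have hly := len_mul_reflW' hB hi hiy
    have hmi := rayMult_pos (P := P) hi
    obtain ⟨q, hq, hmq, hcq⟩ := hd
    have hk := rot_mem hX hq (y * reflW P i)
    have hd1 : Dist P B 𝒜 m (rot q (y * reflW P i)) (y * reflW P i) := ⟨q, hq, hmq, Asym.refl _⟩
    have hd2 : Dist P B 𝒜 (rot q (y * reflW P i)) c (reflW P i) := by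
      have h1 := dist_rot_rot (B := B) hX hq (y * reflW P i) y
      rw [mul_inv_rev, reflW_inv, inv_mul_cancel_right] at h1
      exact h1.congr hB (Asym.refl _) hcq.symm
    have hd3 : Dist P B 𝒜 c (rot q (y * reflW P i)) (reflW P i) := by
      have h1 := hd2.symm hX
      rwa [reflW_inv] at h1
    obtain ⟨n', hn', v', hv', hg', hkn'⟩ :=
      hg.exists_step hB hX hTI hn hk hi (hd3.congr hB hcn (Asym.refl _))
    obtain ⟨h1, h2⟩ := ih _ (by omega) hn' hd1 hk hg' hkn' rfl
    have h3 := le_len_mul_reflW_add hB v hi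
    refine ⟨by rcases hv' with rfl | rfl <;> omega, fun hlen => ?_⟩
    -- If the direction had not changed at the last step, `v` would be no longer than `y * reflW P
    -- i`, which is strictly shorter than `y`.
    have hv'' : v' = v * reflW P i := by
      rcases hv' with rfl | rfl
      · omega
      · rfl
    subst hv''
    obtain ⟨g, hgA, hgs, hgk⟩ := h2 (by omega)
    have hvi : IsPositive P B ((v * reflW P i) • i) := by
      rw [mul_smul, smul_reflW_self, isPositive_reflW_self hB]
      intro h4
      rw [len_mul_reflW hB hi h4] at h1
      omega
    have hgg : GermEq P B m g b := by
      obtain ⟨ε, hε⟩ := exists_zero_lt (α := Λ)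
      exact ⟨ε, hε, fun x hx _ => hgs x hx⟩
    by_cases hcg : Asym P B c (rot g (v * reflW P i * reflW P i))
    · rw [mul_assoc, reflW_mul_self, mul_one] at hcg
      exact ⟨g, hgA, hgs, hcg⟩
    obtain ⟨g₁, hg₁, g₂, hg₂, κ₁, κ₂, hκ, h4, h5, h6, h7⟩ :=
      exists_exchange hB hX hTI hgA hc hi (hd2.congr hB hgk (Asym.refl _)) hcg
    rcases le_or_gt κ₁ (coEval Λ P ((v * reflW P i) • i) b) with hb | hb
    · refine ⟨g₁, hg₁, fun x hx => ?_, ?_⟩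
      · rw [h4, hgs x hx]
        rw [map_add]
        exact le_add_of_le_of_nonneg hb (hx _ hvi)
      · rwa [mul_assoc v, reflW_mul_self, mul_one] at h5
    -- Here the germ would lie in the half of `g₂`, which sees `c` in direction `v * reflW P i`,
    -- against the uniqueness of its direction `v`.
    · exfalso
      have h8 := hg.unique hB hX hn hg₂ (hgg.of_lt (hb.trans_le hκ) h6) hcn h7
      exact reflW_ne_one i (mul_eq_left.1 h8.symm)

/-- Every apartment containing a point contains a chamber at infinity opposite to a given germ at
this point. -/
theorem exists_opposite_germ (hB : IsRootBasis P B) (hX : IsBuildingWithoutA5 P B T 𝒜)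
    (hTI : AxiomA5' P B 𝒜) {m h : V ⊗[F] Λ → X} (hm : m ∈ 𝒜) (hh : h ∈ 𝒜) {a b : V ⊗[F] Λ}
    (hab : h a = m b) :
    ∃ w : P.weylGroup, ∃ n ∈ 𝒜, ∃ v : P.weylGroup, IsLongest B v ∧ GermEq P B m n b ∧
      Asym P B (rot h w) (rot n v) := by
  let S : Set (P.weylGroup × P.weylGroup) :=
    {p | ∃ n ∈ 𝒜, GermEq P B m n b ∧ Asym P B (rot h p.1) (rot n p.2)}
  have hne : S.Nonempty := by
    obtain ⟨n, hn, v, hg, hv⟩ := exists_germEq_asym hB hX hTI hm hh b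
    exact ⟨(1, v), n, hn, hg, by rwa [rot_one]⟩
  -- Among all directions of `h`, choose one whose direction `v` relative to the germ has maximal
  -- length; it is shown that no simple reflection can lengthen `v`.
  obtain ⟨⟨w, v⟩, ⟨n, hn, hg, hwv⟩, hmax⟩ :=
    Set.exists_max_image S (fun p => len B p.2) (Set.toFinite S) hne
  refine ⟨w, n, hn, v, fun i hi hvi => ?_, hg, hwv⟩
  have hmi := rayMult_pos (P := P) hi
  have key : ∀ n' ∈ 𝒜, GermEq P B m n' b →
      ¬ Asym P B (rot h (w * reflW P i)) (rot n' (v * reflW P i)) := by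
    intro n' hn' hg' hasym
    have h1 := hmax (w * reflW P i, v * reflW P i) ⟨n', hn', hg', hasym⟩
    simp only [len_mul_reflW hB hi hvi] at h1
    omega
  have hk := rot_mem hX hh (w * reflW P i)
  have hd : Dist P B 𝒜 (rot n v) (rot h (w * reflW P i)) (reflW P i) := by
    have h1 := dist_rot_rot (B := B) hX hh w (w * reflW P i)
    rw [inv_mul_cancel_left] at h1
    exact h1.congr hB hwv (Asym.refl _)
  obtain ⟨g₁, hg₁, g₂, hg₂, κ₁, κ₂, hκ, h1, h2, h3, h4⟩ :=
    exists_exchange hB hX hTI hn hk hi hd (key n hn hg)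
  rcases le_or_gt κ₁ (coEval Λ P (v • i) b) with hb | hb
  · exact key g₁ hg₁ (hg.of_ge hvi hb h1) h2
  have hb2 := hb.trans_le hκ
  have hna : h a = n b := hab.trans hg.apply.symm
  have h5 : ∀ x ∈ fundChamber Λ P B, h (a + w • x) = n (b + v • x) := by
    intro x hx
    have h6 := hwv.sector_eq hB hX (a := w⁻¹ • a) (b := v⁻¹ • b) (rot_mem hX hh w)
      (rot_mem hX hn v) (by rw [rot_apply, rot_apply, smul_inv_smul, smul_inv_smul, hna]) hx
    rwa [rot_apply, rot_apply, smul_add, smul_add, smul_inv_smul, smul_inv_smul] at h6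
  have h6 : ∀ x ∈ fundChamber Λ P B, h (a + (w * reflW P i) • x) = g₂ (b + v • x) := by
    intro x hx
    have h6 := h4.sector_eq hB hX (a := (w * reflW P i)⁻¹ • a) (b := v⁻¹ • b) hk
      (rot_mem hX hg₂ v) (by
        rw [rot_apply, rot_apply, smul_inv_smul, smul_inv_smul, hna, h3 b hb2.le]) hx
    rwa [rot_apply, rot_apply, smul_add, smul_add, smul_inv_smul, smul_inv_smul] at h6
  -- As `b` is strictly below the wall, `n` and `g₂` agree near it. The sectors of `h` at `a` in two
  -- adjacent directions then have the same germ, which is impossible.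
  have h7 : w = w * reflW P i := by
    refine (weyl_affine_ext (a := 0) (t := 0) (t' := 0) hB (sub_pos.2 hb2)
      fun x hx hs => ?_).1
    rw [zero_add, add_zero, add_zero]
    have h8 : coEval Λ P (v • i) (b + v • x) ≤ κ₂ := by
      rw [map_add, coEval_smul]
      exact (lt_sub_iff_add_lt'.1 (hs i)).le
    have h9 := h5 x hx
    rw [← h3 _ h8, ← h6 x hx] at h9
    exact add_left_cancel (hX.injective h hh h9)
  exact reflW_ne_one i (mul_eq_left.1 h7.symm)

/-- An opposite germ has direction of maximal length, so the inequality of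
`len_le_and_exists_sector` is an equality and the whole sector fits into one apartment with the
chamber at infinity. -/
theorem exists_opposite_sector (hB : IsRootBasis P B) (hX : IsBuildingWithoutA5 P B T 𝒜)
    (hTI : AxiomA5' P B 𝒜) {m h : V ⊗[F] Λ → X} (hm : m ∈ 𝒜) (hh : h ∈ 𝒜) {a b : V ⊗[F] Λ}
    (hab : h a = m b) :
    ∃ w : P.weylGroup, ∃ g ∈ 𝒜, ∃ v : P.weylGroup, IsLongest B v ∧
      (∀ x ∈ fundChamber Λ P B, g (b + x) = m (b + x)) ∧ Asym P B (rot h w) (rot g v) := by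
  obtain ⟨w, n, hn, v, hv, hg, hwv⟩ := exists_opposite_germ hB hX hTI hm hh hab
  have hhw := rot_mem hX hh w
  obtain ⟨y, hy⟩ := exists_dist hB hX hm hhw
  obtain ⟨h1, h2⟩ := len_le_and_exists_sector hB hX hTI hm b hn hy hhw hg hwv
  obtain ⟨g, hgA, hgs, hgw⟩ := h2 (le_antisymm h1 (hv.len_le hB y))
  exact ⟨w, g, hgA, v, hv, hgs, hgw⟩

/-- Every apartment is covered by finitely many apartments containing a given germ. -/
theorem exists_cover (hB : IsRootBasis P B) (hX : IsBuildingWithoutA5 P B T 𝒜)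
    (hTI : AxiomA5' P B 𝒜) {f h : V ⊗[F] Λ → X} (hf : f ∈ 𝒜) (hh : h ∈ 𝒜) (a : V ⊗[F] Λ) :
    ∃ G : P.weylGroup → V ⊗[F] Λ → X, (∀ w, G w ∈ 𝒜 ∧ GermEq P B f (G w) a) ∧
      ∀ p, ∃ w, h p ∈ Set.range (G w) := by
  have h1 := fun w : P.weylGroup => exists_germEq_asym hB hX hTI hf (rot_mem hX hh w) a
  choose G hG v hg hv using h1
  refine ⟨G, fun w => ⟨hG w, hg w⟩, fun p => ?_⟩
  obtain ⟨m, hm, ⟨b, hb⟩, ⟨b', hb'⟩⟩ := hX.A3 (h p) (f a)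
  -- Rotate the chart through both points so that `f a` lies in the fundamental sector based at `h
  -- p`.
  obtain ⟨u, hu⟩ := exists_smul_mem_fundChamber hB (b' - b)
  obtain ⟨w, g, hgA, v', hv', hgs, hgw⟩ := exists_opposite_sector hB hX hTI
    (rot_mem hX hm u⁻¹) hh (a := p) (b := u • b) (by rw [rot_apply, inv_smul_smul, hb])
  have h2 : g (u • b) = h p := by
    have h3 := hgs 0 zero_mem_fundChamber
    rwa [add_zero, rot_apply, inv_smul_smul, hb] at h3
  have h3 : g (u • b') = f a := by
    have h4 := hgs _ hu
    rwa [smul_sub, add_sub_cancel, rot_apply, inv_smul_smul, hb'] at h4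
  -- Since `v'` is longest, `h p` lies in the sector from `f a` towards the opposite chamber `rot h
  -- w`. By `Asym.sector_eq` this sector lies in the apartment of `G w`.
  have h4 : v'⁻¹ • (u • b - u • b') ∈ fundChamber Λ P B := by
    intro i hi
    have h5 := coEval_nonpos_of_not_isPositive hB (hv'.not_isPositive hB hi) hu
    rw [coEval_smul', inv_inv, ← neg_sub, map_neg, ← smul_sub]
    exact neg_nonneg.2 h5
  have h5 := (hgw.symm.trans hB (hv w)).sector_eq hB hX (a := v'⁻¹ • u • b')
    (b := (v w)⁻¹ • a) (rot_mem hX hgA v') (rot_mem hX (hG w) (v w)) (by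
      rw [rot_apply, rot_apply, smul_inv_smul, smul_inv_smul, h3, (hg w).apply]) h4
  rw [rot_apply, smul_add, smul_inv_smul, smul_inv_smul, add_sub_cancel, h2] at h5
  exact ⟨w, _, h5.symm⟩

end Germs

/-! ### Piecewise non-expanding maps of the model space. -/

section Piecewise

variable {ι V N Λ : Type*} {F : Subfield ℝ}
variable [AddCommGroup V] [Module F V] [AddCommGroup N] [Module F N]
variable [AddCommGroup Λ] [LinearOrder Λ] [IsOrderedAddMonoid Λ] [Module F Λ]
variable {P : RootPairing ι F V N} {B : Finset ι}
variable [Fintype ι] [P.IsRootSystem] [IsOrderedModule F Λ]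

open Classical in
theorem modelDist_zero_add {x y : V ⊗[F] Λ} (hx : x ∈ fundChamber Λ P B)
    (hy : y ∈ fundChamber Λ P B) :
    modelDist P B 0 (x + y) = modelDist P B 0 x + modelDist P B 0 y := by
  rw [modelDist, modelDist, modelDist, ← Finset.sum_add_distrib]
  refine Finset.sum_congr rfl fun i hi => ?_
  have hi := (Finset.mem_filter.1 hi).2
  rw [sub_zero, sub_zero, sub_zero, map_add, abs_of_nonneg (hx i hi), abs_of_nonneg (hy i hi),
    abs_of_nonneg (add_nonneg (hx i hi) (hy i hi))]

variable {κ : Type*} [Finite κ] {φ : V ⊗[F] Λ → V ⊗[F] Λ} {J : κ → Finset (ι × Λ)}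

/-- A map that does not increase distances on each of finitely many convex pieces does not
increase the distance along a segment. -/
theorem modelDist_le_of_piecewise_segment
    (hφ : ∀ k x y, (∀ c ∈ J k, c.2 ≤ coEval Λ P c.1 x) → (∀ c ∈ J k, c.2 ≤ coEval Λ P c.1 y) →
      modelDist P B (φ x) (φ y) ≤ modelDist P B x y)
    (hJ : ∀ x, ∃ k, ∀ c ∈ J k, c.2 ≤ coEval Λ P c.1 x) (p : V ⊗[F] Λ) (v : V) {s t : Λ}
    (hst : s ≤ t) :
    modelDist P B (φ (p + v ⊗ₜ s)) (φ (p + v ⊗ₜ t)) ≤ rootNorm P B v • (t - s) := by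
  -- The parameters where the line crosses a bounding wall transversally. They are finite in number,
  -- and the induction is on how many lie strictly inside the segment.
  let Z : Set Λ := ⋃ k, ⋃ c ∈ J k, {l | P.coroot' c.1 v ≠ 0 ∧
    coEval Λ P c.1 (p + v ⊗ₜ l) = c.2}
  have hZ : Z.Finite := by
    refine Set.finite_iUnion fun k => (J k).finite_toSet.biUnion fun c _ =>
      Set.Subsingleton.finite ?_
    rintro l ⟨h0, h1⟩ l' ⟨-, h2⟩
    have h3 := h1.trans h2.symm
    rw [map_add, map_add, coEval_tmul, coEval_tmul] at h3
    have h4 := congrArg (fun x => (P.coroot' c.1 v)⁻¹ • x) (add_left_cancel h3)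
    simpa only [inv_smul_smul₀ h0] using h4
  have key : ∀ n : ℕ, ∀ s t : Λ, s ≤ t → (Z ∩ Set.Ioo s t).ncard = n →
      modelDist P B (φ (p + v ⊗ₜ s)) (φ (p + v ⊗ₜ t)) ≤ rootNorm P B v • (t - s) := by
    intro n
    induction n using Nat.strong_induction_on with
    | _ n ih =>
    intro s t hst hn
    rcases (Z ∩ Set.Ioo s t).eq_empty_or_nonempty with he | ⟨l, hlZ, hsl, hlt⟩
    -- With no crossing inside, a piece containing the midpoint contains the whole closed segment: a
    -- constraint that holds at `m` and fails at some `r` would have its crossing in the open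
    -- interval.
    · let m : Λ := (2 : F)⁻¹ • (s + t)
      have hm : m + m = s + t := by
        rw [← two_smul F m, smul_inv_smul₀ two_ne_zero]
      obtain ⟨k, hk⟩ := hJ (p + v ⊗ₜ m)
      have hmem : ∀ r, s ≤ r → r ≤ t → ∀ c ∈ J k, c.2 ≤ coEval Λ P c.1 (p + v ⊗ₜ r) := by
        intro r hsr hrt c hc
        have h1 := hk c hc
        rw [map_add, coEval_tmul] at h1 ⊢
        by_contra hlt
        rw [not_le] at hlt
        have h0 : P.coroot' c.1 v ≠ 0 := by
          intro h0
          rw [h0, zero_smul] at h1 hlt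
          exact absurd hlt (not_lt.2 h1)
        let l : Λ := (P.coroot' c.1 v)⁻¹ • (c.2 - coEval Λ P c.1 p)
        have hl : P.coroot' c.1 v • l = c.2 - coEval Λ P c.1 p := smul_inv_smul₀ h0 _
        have hlm : P.coroot' c.1 v • l ≤ P.coroot' c.1 v • m := by
          rw [hl]; exact sub_le_iff_le_add'.2 h1
        have hlr : P.coroot' c.1 v • r < P.coroot' c.1 v • l := by
          rw [hl]; exact lt_sub_iff_add_lt'.2 hlt
        have hlZ : l ∈ Z := by
          refine Set.mem_iUnion.2 ⟨k, Set.mem_iUnion₂.2 ⟨c, hc, h0, ?_⟩⟩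
          rw [map_add, coEval_tmul, hl, add_sub_cancel]
        have hsm : s < t → s < m ∧ m < t := by
          intro h
          constructor
          · by_contra h'
            rw [not_lt] at h'
            exact absurd hm (add_lt_add_of_le_of_lt h' (h'.trans_lt h)).ne
          · by_contra h'
            rw [not_lt] at h'
            exact absurd hm (add_lt_add_of_lt_of_le (h.trans_le h') h').ne'
        have hst' : s < t := by
          refine lt_of_le_of_ne hst fun h => ?_
          subst h
          have hr : r = s := le_antisymm hrt hsr
          have hms : m = s := by
            rw [← inv_smul_smul₀ (two_ne_zero (α := F)) s, two_smul]
          rw [hr, ← hms] at hlr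
          exact absurd hlm (not_le.2 hlr)
        obtain ⟨h2, h3⟩ := hsm hst'
        have hin : l ∈ Set.Ioo s t := by
          rcases lt_or_gt_of_ne h0 with hneg | hpos
          · have h4 : l < r := lt_of_not_ge fun h =>
              absurd hlr (not_lt.2 (smul_le_smul_of_nonpos_left h hneg.le))
            have h5 : m ≤ l := le_of_not_gt fun h => by
              have h6 := smul_pos_of_pos (neg_pos.2 hneg) (sub_pos.2 h)
              rw [neg_smul, smul_sub, neg_sub] at h6
              exact absurd hlm (not_le.2 (sub_pos.1 h6))
            exact ⟨h2.trans_le h5, h4.trans_le hrt⟩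
          · have h4 : r < l := lt_of_not_ge fun h =>
              absurd hlr (not_lt.2 (smul_le_smul_of_nonneg_left h hpos.le))
            have h5 : l ≤ m := le_of_not_gt fun h => by
              have h6 := smul_pos_of_pos hpos (sub_pos.2 h)
              rw [smul_sub] at h6
              exact absurd hlm (not_le.2 (sub_pos.1 h6))
            exact ⟨hsr.trans_lt h4, h5.trans_lt h3⟩
        exact (Set.eq_empty_iff_forall_notMem.1 he) l ⟨hlZ, hin⟩
      refine (hφ k _ _ (hmem s le_rfl hst) (hmem t hst le_rfl)).trans_eq ?_
      have h1 : p + v ⊗ₜ[F] t = p + v ⊗ₜ s + v ⊗ₜ (t - s) := by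
        rw [add_assoc, ← TensorProduct.tmul_add, add_sub_cancel]
      rw [h1, modelDist_add_tmul _ _ (sub_nonneg.2 hst)]
    · have hadd : l - s + (t - l) = t - s := by abel
      have hfin : (Z ∩ Set.Ioo s t).Finite := hZ.inter_of_left _
      have h1 := ih _ (hn ▸ Set.ncard_lt_ncard (t := Z ∩ Set.Ioo s t) (s := Z ∩ Set.Ioo s l)
        ⟨fun x hx => ⟨hx.1, hx.2.1, hx.2.2.trans hlt⟩,
          fun h => (h ⟨hlZ, hsl, hlt⟩).2.2.ne rfl⟩ hfin) s l hsl.le rfl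
      have h2 := ih _ (hn ▸ Set.ncard_lt_ncard (t := Z ∩ Set.Ioo s t) (s := Z ∩ Set.Ioo l t)
        ⟨fun x hx => ⟨hx.1, hsl.trans hx.2.1, hx.2.2⟩,
          fun h => (h ⟨hlZ, hsl, hlt⟩).2.1.ne rfl⟩ hfin) l t hlt.le rfl
      have h3 := (modelDist_triangle _ _ _).trans (add_le_add h1 h2)
      rwa [← smul_add, hadd] at h3
  exact key _ s t hst rfl

/-- A map that does not increase distances on each of finitely many convex pieces covering the
model space does not increase distances. -/
theorem modelDist_le_of_piecewise (hB : IsRootBasis P B)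
    (hφ : ∀ k x y, (∀ c ∈ J k, c.2 ≤ coEval Λ P c.1 x) → (∀ c ∈ J k, c.2 ≤ coEval Λ P c.1 y) →
      modelDist P B (φ x) (φ y) ≤ modelDist P B x y)
    (hJ : ∀ x, ∃ k, ∀ c ∈ J k, c.2 ≤ coEval Λ P c.1 x) (x y : V ⊗[F] Λ) :
    modelDist P B (φ x) (φ y) ≤ modelDist P B x y := by
  classical
  obtain ⟨w, hw⟩ := exists_smul_mem_fundChamber hB (y - x)
  obtain ⟨ω, hω, hsum⟩ := exists_eq_sum_tmul (Λ := Λ) hB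
  -- Travel from `x` to `y` along one fundamental weight at a time. The steps all lie in one Weyl
  -- chamber, where lengths add up, so no distance is lost to the subdivision.
  have key : ∀ S ⊆ B, ∑ j ∈ S, ω j ⊗ₜ coEval Λ P j (w • (y - x)) ∈ fundChamber Λ P B ∧
      modelDist P B (φ x) (φ (x + w⁻¹ • ∑ j ∈ S, ω j ⊗ₜ coEval Λ P j (w • (y - x)))) ≤
        modelDist P B 0 (∑ j ∈ S, ω j ⊗ₜ coEval Λ P j (w • (y - x))) := by
    intro S
    induction S using Finset.induction_on with
    | empty =>
      intro _
      rw [Finset.sum_empty, smul_zero, add_zero, modelDist_self, modelDist_self]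
      exact ⟨zero_mem_fundChamber, le_rfl⟩
    | insert j S hj ih =>
      intro hS
      obtain ⟨h1, h2⟩ := ih ((Finset.subset_insert j S).trans hS)
      have hjB := hS (Finset.mem_insert_self j S)
      have hl := hw j (isPositive_of_mem hjB)
      have h3 := tmul_mem_fundChamber (hω j hjB) hl
      rw [Finset.sum_insert hj]
      refine ⟨add_mem_fundChamber h3 h1, ?_⟩
      generalize ∑ j ∈ S, ω j ⊗ₜ[F] coEval Λ P j (w • (y - x)) = σ at h1 h2 ⊢
      generalize coEval Λ P j (w • (y - x)) = l at hl h3 ⊢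
      have h4 := modelDist_le_of_piecewise_segment hφ hJ (x + w⁻¹ • σ) (w⁻¹ • ω j) hl
      have h5 := modelDist_smul_add hB w⁻¹ 0 0 (ω j ⊗ₜ[F] l)
      have h6 := modelDist_add_tmul (P := P) (B := B) 0 (w⁻¹ • ω j) hl
      rw [smul_zero, add_zero, add_zero, smul_tmul_weyl] at h5
      rw [zero_add] at h6
      rw [TensorProduct.tmul_zero, add_zero, sub_zero, ← h6, h5] at h4
      have h7 : x + w⁻¹ • (ω j ⊗ₜ[F] l + σ) = x + w⁻¹ • σ + (w⁻¹ • ω j) ⊗ₜ[F] l := by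
        rw [smul_add, smul_tmul_weyl, add_comm ((w⁻¹ • ω j) ⊗ₜ[F] l), add_assoc]
      rw [h7, add_comm (ω j ⊗ₜ[F] l), modelDist_zero_add h1 h3]
      exact (modelDist_triangle _ _ _).trans (add_le_add h2 h4)
  have h1 := (key B subset_rfl).2
  rw [← hsum, inv_smul_smul, add_sub_cancel] at h1
  refine h1.trans_eq ?_
  have h2 := modelDist_smul_add hB w⁻¹ x 0 (w • (y - x))
  rwa [smul_zero, zero_add, inv_smul_smul, sub_add_cancel, eq_comm] at h2

end Piecewise

/-! ### The equivalence of the two axioms. -/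

section Retraction

variable {ι V N Λ X : Type*} {F : Subfield ℝ}
variable [AddCommGroup V] [Module F V] [AddCommGroup N] [Module F N]
variable [AddCommGroup Λ] [LinearOrder Λ] [IsOrderedAddMonoid Λ] [Module F Λ]
variable {P : RootPairing ι F V N} {B : Finset ι}
variable {T : AddSubgroup (V ⊗[F] Λ)} {𝒜 : Set (V ⊗[F] Λ → X)}
variable [Fintype ι] [P.IsRootSystem] [IsOrderedModule F Λ]

theorem axiomA5'_of_axiomA5 (hB : IsRootBasis P B) (hX : IsBuildingWithoutA5 P B T 𝒜)
    (h : AxiomA5 P B 𝒜) : AxiomA5' P B 𝒜 := by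
  intro x y z
  obtain ⟨f, hf, hx, hy⟩ := hX.A3 x y
  obtain ⟨r, hr, hid, hle, -⟩ := h f hf x hx
  have h1 := hle x z
  have h2 := hle z y
  rw [hid x hx] at h1
  rw [hid y hy] at h2
  obtain ⟨c, hc⟩ := hr z
  obtain ⟨a, rfl⟩ := hx
  obtain ⟨b, rfl⟩ := hy
  rw [← hc, inducedDist_eq hB hX hf] at h1 h2
  rw [inducedDist_eq hB hX hf]
  exact (modelDist_triangle a c b).trans (add_le_add h1 h2)

variable [Nontrivial Λ]

theorem axiomA5_of_axiomA5' (hB : IsRootBasis P B) (hX : IsBuildingWithoutA5 P B T 𝒜)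
    (hTI : AxiomA5' P B 𝒜) : AxiomA5 P B 𝒜 := by
  rintro f hf _ ⟨a, rfl⟩
  have hex : ∀ y, ∃ p, ∃ g ∈ 𝒜, GermEq P B f g a ∧ g p = y := by
    intro y
    obtain ⟨h, hh, ⟨p, rfl⟩, -⟩ := hX.A3 y y
    obtain ⟨G, hG, hcov⟩ := exists_cover hB hX hTI hf hh a
    obtain ⟨w, q, hq⟩ := hcov p
    exact ⟨q, G w, (hG w).1, (hG w).2, hq⟩
  choose R g hg hga hgR using hex
  -- The coordinate `R` does not depend on the chosen chart, because charts sharing the germ agree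
  -- wherever their apartments meet.
  have hR : ∀ n ∈ 𝒜, GermEq P B f n a → ∀ p, R (n p) = p := by
    intro n hn hna p
    have h1 := hna.eq_of_mem hB hX hn (hg (n p)) (hga (n p)) (x := p) ⟨_, hgR _⟩
    exact hX.injective _ (hg (n p)) ((hgR _).trans h1)
  refine ⟨fun y => f (R y), fun y => ⟨_, rfl⟩, ?_, fun y z => ?_, ?_⟩
  · rintro _ ⟨p, rfl⟩
    exact congrArg f (hR f hf (GermEq.refl f a) p)
  · obtain ⟨h, hh, ⟨p, rfl⟩, ⟨q, rfl⟩⟩ := hX.A3 y z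
    rw [inducedDist_eq hB hX hf, inducedDist_eq hB hX hh]
    obtain ⟨G, hG, hcov⟩ := exists_cover hB hX hTI hf hh a
    -- Only the apartments that meet the one of `h` are kept, since transition maps and convexity
    -- need a common point. On each piece `R ∘ h` is an affine Weyl element, hence an isometry.
    let κ := {w : P.weylGroup // ∃ x, h x ∈ Set.range (G w)}
    have h1 : ∀ k : κ, ∃ (J : Finset (ι × Λ)) (u : P.weylGroup) (t : V ⊗[F] Λ),
        (∀ x, h x ∈ Set.range (G k.1) ↔ ∀ p ∈ J, p.2 ≤ coEval Λ P p.1 x) ∧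
          ∀ x, h x ∈ Set.range (G k.1) → h x = G k.1 (u • x + t) := by
      rintro ⟨w, x, y, hxy⟩
      obtain ⟨J, u, t, -, h⟩ := exists_transition hX hh (hG w).1 hxy.symm
      exact ⟨J, u, t, h⟩
    choose J u t hJ hut using h1
    refine modelDist_le_of_piecewise (κ := κ) (φ := fun x => R (h x)) (J := J) hB ?_ ?_ p q
    · intro k x y hx hy
      rw [hut k x ((hJ k x).2 hx), hut k y ((hJ k y).2 hy), hR _ (hG k.1).1 (hG k.1).2,
        hR _ (hG k.1).1 (hG k.1).2, modelDist_smul_add hB]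
    · intro x
      obtain ⟨w, hw⟩ := hcov x
      exact ⟨⟨w, x, hw⟩, (hJ ⟨w, x, hw⟩ x).1 hw⟩
  · ext y
    simp only [Set.mem_preimage, Set.mem_singleton_iff]
    constructor
    -- All charts used send `a` to the centre `f a`, so a point with coordinate `a` is the centre.
    · intro hy
      have h1 : R y = a := hX.injective f hf hy
      rw [← hgR y, h1, (hga y).apply]
    · rintro rfl
      rw [hR f hf (GermEq.refl f a)]

end Retraction

end GenAffineBuilding

end

theorem mainTheorem10 {ι V N Λ X : Type*} [Fintype ι] {F : Subfield ℝ}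
    [AddCommGroup V] [Module F V] [AddCommGroup N] [Module F N]
    [AddCommGroup Λ] [LinearOrder Λ] [IsOrderedAddMonoid Λ] [Module F Λ] [IsOrderedModule F Λ]
    (P : RootPairing ι F V N) [P.IsRootSystem]
    (B : Finset ι) (hB : GenAffineBuilding.IsRootBasis P B)
    (T : AddSubgroup (TensorProduct F V Λ)) (hT : T ≠ ⊥)
    (hTW : GenAffineBuilding.IsWeylStable P T)
    (𝒜 : Set (TensorProduct F V Λ → X))
    (h𝒜 : GenAffineBuilding.IsBuildingWithoutA5 P B T 𝒜) :
    GenAffineBuilding.AxiomA5 P B 𝒜 ↔ GenAffineBuilding.AxiomA5' P B 𝒜 := by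
  -- A non-trivial translation group requires Λ ≠ 0, which supplies the positive elements needed for
  -- germs and unbounded rays.
  have hΛ : Nontrivial Λ := by
    by_contra h
    rw [not_nontrivial_iff_subsingleton] at h
    refine hT ((AddSubgroup.eq_bot_iff_forall T).2 fun x _ => ?_)
    clear * -h
    induction x using TensorProduct.induction_on with
    | zero => rfl
    | tmul v c => rw [Subsingleton.elim c 0, TensorProduct.tmul_zero]
    | add x y hx hy => rw [hx, hy, add_zero]
  exact ⟨GenAffineBuilding.axiomA5'_of_axiomA5 hB h𝒜, GenAffineBuilding.axiomA5_of_axiomA5' hB h𝒜⟩
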